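/- Let $k$ be an algebraically closed field of characteristic $0$ and let $X$ be a smooth projective (irreducible) surface over $k$. Let $T^*_X \to X$ be the total space of the cotangent bundle of $X$. For $n \ge 0$ let $$\mathrm{Chow}^n(T^*_X/X) = (T^*_X\times_X\cdots\times_X T^*_X)/S_n$$ be the quotient of the $n$-fold fibre power over $X$ by the permutations of the factors (so $\mathrm{Chow}^0(T^*_X/X)=X$); its points are written as cycles $z_1+\cdots+z_n$. A spectral datum of degree $n$ is a section $a : X \to \mathrm{Chow}^n(T^*_X/X)$ of the projection to $X$. For a partition $\mu=(1^{\alpha_1},2^{\alpha_2},\dots,s^{\alpha_s})$ of $n$, where $\alpha_j\ge 0$ is the number of parts equal to $j$ and $\sum_j j\alpha_j = n$, let $\mathrm{Chow}^n_\mu(T^*_X/X)\subseteq \mathrm{Chow}^n(T^*_X/X)$ be the set of cycles in which, for each $j$, exactly $\alpha_j$ distinct points occur with multiplicity $j$. Let $$\tau_\mu : \prod_{j=1,\,X}^{s}\mathrm{Chow}^{\alpha_j}(T^*_X/X)\to \mathrm{Chow}^n(T^*_X/X),\qquad (c_1,\dots,c_s)\mapsto c_1+2c_2+\cdots+s c_s,$$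 be the morphism over $X$ that is induced on the quotients by $\big((z_{j,m})_{1\le m\le\alpha_j}\big)_{1\le j\le s}\mapsto\sum_{j}\sum_m j\, z_{j,m}$. Theorem. The morphism $\tau_\mu$ exists, and if $a : X\to\mathrm{Chow}^n(T^*_X/X)$ is a spectral datum that maps the generic point of $X$ into the stratum $\mathrm{Chow}^n_\mu(T^*_X/X)$, then there are spectral data $a_j : X\to\mathrm{Chow}^{\alpha_j}(T^*_X/X)$, $j=1,\dots,s$, such that each $a_j$ maps the generic point of $X$ into $\mathrm{Chow}^{\alpha_j}_{(1^{\alpha_j})}(T^*_X/X)$, has image in the closure of this stratum, and $$a=\sum_{j=1}^s j\,a_j,\qquad\text{that is,}\qquad a=\tau_\mu\circ(a_1,\dots,a_s).$$ -/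

import Mathlib

open CategoryTheory Limits AlgebraicGeometry

universe u

namespace SpectralData

section RelSpec
open Scheme AffineZariskiSite
variable {X : Scheme.{u}} {F : X.AffineZariskiSiteᵒᵖ ⥤ CommRingCat.{u}}
  {α : (toOpensFunctor X).op ⋙ X.presheaf ⟶ F}

theorem spec_map_isoSpec_inv_ι {R : CommRingCat.{u}} {U : X.Opens} (hU : IsAffineOpen U)
    (φ : Γ(X, U) ⟶ R) :
    (Spec.map φ ≫ hU.isoSpec.inv) ≫ U.ι = Spec.map φ ≫ hU.fromSpec := by
  rw [Category.assoc, IsAffineOpen.isoSpec_inv_ι]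

theorem toSpecΓ_spec_map_fromSpec {R : CommRingCat.{u}} {Y : Scheme.{u}} (π : Y ⟶ X)
    {U : X.Opens} (hU : IsAffineOpen U) (φ : Γ(X, U) ⟶ R) (θ : R ⟶ Γ(Y, π ⁻¹ᵁ U))
    (h : φ ≫ θ = π.app U) :
    (π ⁻¹ᵁ U).toSpecΓ ≫ Spec.map θ ≫ Spec.map φ ≫ hU.fromSpec = (π ⁻¹ᵁ U).ι ≫ π := by
  rw [← Spec.map_comp_assoc, h]
  simp

theorem pullback_map_isoRestrict {Y : Scheme.{u}} (π : Y ⟶ X) {U V : X.Opens} (i : U ≤ V)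
    (h1) (h2) :
    pullback.map π U.ι π V.ι (𝟙 Y) (X.homOfLE i) (𝟙 X) h1 h2 ≫
      (pullbackRestrictIsoRestrict π V).hom =
      (pullbackRestrictIsoRestrict π U).hom ≫ Y.homOfLE (π.preimage_mono i) := by
  rw [← cancel_mono (Scheme.Opens.ι _)]
  simp only [Category.assoc, pullbackRestrictIsoRestrict_hom_ι, Scheme.homOfLE_ι]
  exact (pullback.lift_fst _ _ _).trans (Category.comp_id _)

/-- The relative spectrum over `X` of a quasi-coherent `O_X`-algebra, which is given by its sections
`F` over the affine opens of `X` and the structure map `α : O_X ⟶ F`: the condition `H` says that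
`F(D(r))` is the localization `F(U)_r` for all `r ∈ O_X(U)`. -/
noncomputable def RelSpec (H : α.Coequifibered) : Scheme.{u} := (relativeGluingData H).glued

/-- The projection of a relative spectrum to the base. -/
noncomputable def RelSpec.toBase (H : α.Coequifibered) : RelSpec H ⟶ X :=
  (relativeGluingData H).toBase

/-- The open piece `Spec F(U)` of the relative spectrum, over an affine open `U` of `X`. -/
noncomputable def RelSpec.ι (H : α.Coequifibered) (U : X.AffineZariskiSite) :
    Spec (F.obj (.op U)) ⟶ RelSpec H :=
  (relativeGluingData H).cover.f U

instance RelSpec.isOpenImmersion_ι (H : α.Coequifibered) (U : X.AffineZariskiSite) :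
    IsOpenImmersion (RelSpec.ι H U) :=
  (relativeGluingData H).cover.map_prop U

theorem RelSpec.map_ι (H : α.Coequifibered) {U V : X.AffineZariskiSite} (i : U ⟶ V) :
    Spec.map (F.map i.op) ≫ RelSpec.ι H V = RelSpec.ι H U :=
  (relativeGluingData H).cover.trans_map i

theorem RelSpec.ι_toBase (H : α.Coequifibered) (U : X.AffineZariskiSite) :
    RelSpec.ι H U ≫ RelSpec.toBase H = Spec.map (α.app (.op U)) ≫ U.2.fromSpec := by
  refine ((relativeGluingData H).ι_toBase U).trans ?_
  exact spec_map_isoSpec_inv_ι U.2 (α.app (.op U))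

theorem RelSpec.toBase_preimage (H : α.Coequifibered) (U : X.AffineZariskiSite) :
    RelSpec.toBase H ⁻¹ᵁ U.1 = (RelSpec.ι H U).opensRange := by
  refine Eq.trans ?_ ((relativeGluingData H).toBase_preimage_eq_opensRange_ι U)
  change _ = (relativeGluingData H).toBase ⁻¹ᵁ U.1.ι.opensRange
  rw [Scheme.Opens.opensRange_ι]
  rfl

instance RelSpec.isAffineHom_toBase (H : α.Coequifibered) : IsAffineHom (RelSpec.toBase H) := by
  refine isAffineHom_of_forall_exists_isAffineOpen _ fun x ↦ ?_
  obtain ⟨U, hxU⟩ := TopologicalSpace.Opens.mem_iSup.mp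
    ((iSup_affineOpens_eq_top X).ge (Set.mem_univ x))
  refine ⟨U, hxU, U.2, ?_⟩
  have := RelSpec.isOpenImmersion_ι H U
  exact (RelSpec.toBase_preimage H U) ▸ isAffineOpen_opensRange (RelSpec.ι H U)

section lift
variable (H : α.Coequifibered) {Y : Scheme.{u}} (π : Y ⟶ X)
  (θ : ∀ U : X.AffineZariskiSite, F.obj (.op U) ⟶ Γ(Y, π ⁻¹ᵁ U.1))

/-- The morphism `π⁻¹(U) ⟶ Spec F(U) ⟶ RelSpec F` given by `θ U : F(U) ⟶ O_Y(π⁻¹(U))`. -/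
noncomputable def RelSpec.liftPiece (U : X.AffineZariskiSite) : (π ⁻¹ᵁ U.1).toScheme ⟶ RelSpec H :=
  (π ⁻¹ᵁ U.1).toSpecΓ ≫ Spec.map (θ U) ≫ RelSpec.ι H U

theorem RelSpec.homOfLE_liftPiece
    (hθ : ∀ {U V : X.AffineZariskiSite} (i : U ⟶ V), F.map i.op ≫ θ U =
      θ V ≫ Y.presheaf.map (homOfLE (π.preimage_mono (toOpens_mono i.le))).op)
    {U V : X.AffineZariskiSite} (i : U ⟶ V) :
    Y.homOfLE (π.preimage_mono (toOpens_mono i.le)) ≫ RelSpec.liftPiece H π θ V =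
      RelSpec.liftPiece H π θ U := by
  rw [liftPiece, liftPiece, ← Scheme.Opens.toSpecΓ_SpecMap_presheaf_map_assoc,
    ← RelSpec.map_ι H i, ← Spec.map_comp_assoc, ← Spec.map_comp_assoc, hθ i]

theorem RelSpec.trans_liftPiece
    (hθ : ∀ {U V : X.AffineZariskiSite} (i : U ⟶ V), F.map i.op ≫ θ U =
      θ V ≫ Y.presheaf.map (homOfLE (π.preimage_mono (toOpens_mono i.le))).op)
    {U V : ((directedCover X).pullback₁ π).I₀} (i : U ⟶ V) :
    Cover.trans ((directedCover X).pullback₁ π) i ≫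
      (pullbackRestrictIsoRestrict π (Subtype.val V)).hom ≫ RelSpec.liftPiece H π θ V =
    (pullbackRestrictIsoRestrict π (Subtype.val U)).hom ≫ RelSpec.liftPiece H π θ U := by
  let i' : @Quiver.Hom X.AffineZariskiSite _ U V := i
  have h := pullback_map_isoRestrict π (toOpens_mono (X := X) i'.le) (by simp) (by simp)
  have := h =≫ RelSpec.liftPiece H π θ V
  simp only [Category.assoc] at this
  rw [RelSpec.homOfLE_liftPiece H π θ hθ i'] at this
  exact this

variable (hθ : ∀ {U V : X.AffineZariskiSite} (i : U ⟶ V), F.map i.op ≫ θ U =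
      θ V ≫ Y.presheaf.map (homOfLE (π.preimage_mono (toOpens_mono i.le))).op)

/-- The morphism `Y ⟶ RelSpec F` over `X` that is given by a map `θ : F ⟶ π_* O_Y`. -/
noncomputable def RelSpec.lift : Y ⟶ RelSpec H :=
  Scheme.OpenCover.glueMorphismsOfLocallyDirected ((directedCover X).pullback₁ π)
    (fun U ↦ (pullbackRestrictIsoRestrict π (Subtype.val U)).hom ≫ RelSpec.liftPiece H π θ U)
    (RelSpec.trans_liftPiece H π θ hθ)

theorem RelSpec.ι_lift (U : X.AffineZariskiSite) :
    (π ⁻¹ᵁ U.1).ι ≫ RelSpec.lift H π θ hθ = RelSpec.liftPiece H π θ U := by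
  rw [← cancel_epi (pullbackRestrictIsoRestrict π U.1).hom, ← Category.assoc,
    pullbackRestrictIsoRestrict_hom_ι]
  exact Scheme.OpenCover.map_glueMorphismsOfLocallyDirected ((directedCover X).pullback₁ π)
    (fun U ↦ (pullbackRestrictIsoRestrict π (Subtype.val U)).hom ≫ RelSpec.liftPiece H π θ U)
    (RelSpec.trans_liftPiece H π θ hθ) U

theorem RelSpec.lift_toBase
    (hα : ∀ U : X.AffineZariskiSite, α.app (.op U) ≫ θ U = π.app U.1) :
    RelSpec.lift H π θ hθ ≫ RelSpec.toBase H = π := by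
  have key (U : X.AffineZariskiSite) : (π ⁻¹ᵁ U.1).ι ≫ RelSpec.lift H π θ hθ ≫ RelSpec.toBase H =
      (π ⁻¹ᵁ U.1).ι ≫ π := by
    rw [← Category.assoc, RelSpec.ι_lift H π θ hθ U, liftPiece, Category.assoc, Category.assoc,
      RelSpec.ι_toBase H]
    exact toSpecΓ_spec_map_fromSpec π U.2 _ _ (hα U)
  exact Scheme.Cover.hom_ext (Y.openCoverOfIsOpenCover _
    (.comap (iSup_affineOpens_eq_top X) π.base.1)) _ _ key
end lift
end RelSpec


theorem isAffineHom_base_of_isLimit {I : Type} {X : Scheme.{u}} {Y : I → Scheme.{u}}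
    {p : ∀ i, Y i ⟶ X} {s t : WidePullbackCone p} (hs : IsLimit s) (ht : IsLimit t)
    (h : IsAffineHom t.base) : IsAffineHom s.base := by
  have : s.base = (hs.conePointUniqueUpToIso ht).hom ≫ t.base :=
    (hs.conePointUniqueUpToIso_hom_comp ht none).symm
  rw [this]
  infer_instance

theorem isAffineHom_pullback_fst {X Y Z : Scheme.{u}} (f : X ⟶ Z) (g : Y ⟶ Z)
    (h : IsAffineHom g) : IsAffineHom (pullback.fst f g) :=
  MorphismProperty.IsStableUnderBaseChange.of_isPullback (P := @IsAffineHom.{u})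
    (IsPullback.of_hasPullback f g).flip h

theorem isAffineHom_widePullbackCone_base (I : Type) [Finite I] {X : Scheme.{u}} :
    ∀ (Y : I → Scheme.{u}) (p : ∀ i, Y i ⟶ X) (_ : ∀ i, IsAffineHom (p i))
      (s : WidePullbackCone p), IsLimit s → IsAffineHom s.base := by
  induction I using Finite.induction_empty_option with
  | of_equiv e ih =>
    exact fun Y p hp s hs ↦ ih (fun i ↦ Y (e i)) (fun i ↦ p (e i)) (fun i ↦ hp _) (s.reindex e)
      ((s.reindexIsLimitEquiv e).symm hs)
  | h_empty =>
    intro Y p hp s hs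
    refine isAffineHom_base_of_isLimit hs (t := .mk (𝟙 X) (fun i ↦ i.elim) (fun i ↦ i.elim))
      (WidePullbackCone.IsLimit.mk _ (fun t ↦ t.base) (fun t ↦ Category.comp_id t.base)
        (fun t i ↦ i.elim) (fun t m hm _ ↦ (Category.comp_id m).symm.trans hm)) ?_
    exact inferInstanceAs (IsAffineHom (𝟙 X))
  | @h_option I _ ih =>
    intro Y p hp s hs
    let t := limit.cone (WidePullbackShape.wideCospan X (fun i ↦ Y (some i)) (fun i ↦ p (some i)))
    let ht : IsLimit t := limit.isLimit _
    have h1 := ih (fun i ↦ Y (some i)) (fun i ↦ p (some i)) (fun i ↦ hp _) t ht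
    have h2 := hp none
    let b : pullback (p none) (WidePullbackCone.base t) ⟶ X := pullback.fst _ _ ≫ p none
    have hb : pullback.snd (p none) (WidePullbackCone.base t) ≫ WidePullbackCone.base t = b :=
      pullback.condition.symm
    refine isAffineHom_base_of_isLimit hs (t := .mk b
      (fun i ↦ match i with
        | none => pullback.fst _ _
        | some i => pullback.snd _ _ ≫ WidePullbackCone.π t i) ?_)
      (WidePullbackCone.IsLimit.mk _ (fun r ↦ pullback.lift (r.π none)
        (WidePullbackCone.IsLimit.lift ht r.base (fun i ↦ r.π (some i)) (fun i ↦ r.condition _))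
          ?_) ?_ ?_ ?_) ?_
    · rintro (_ | i)
      · rfl
      · exact (Category.assoc _ _ _).trans
          ((congrArg _ (WidePullbackCone.condition t i)).trans hb)
    · rw [WidePullbackCone.IsLimit.lift_base, WidePullbackCone.condition]
    · intro r
      exact (pullback.lift_fst_assoc _ _ _ _).trans (r.condition none)
    · rintro r (_ | i)
      · exact pullback.lift_fst _ _ _
      · exact (pullback.lift_snd_assoc _ _ _ _).trans (WidePullbackCone.IsLimit.lift_π _ _ _ _ _)
    · intro r m hm hm'
      apply pullback.hom_ext
      · exact (hm' none).trans (pullback.lift_fst _ _ _).symm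
      · refine Eq.trans ?_ (pullback.lift_snd _ _ _).symm
        refine WidePullbackCone.IsLimit.hom_ext ht ?_ fun i ↦ ?_
        · rw [WidePullbackCone.IsLimit.lift_base]
          exact (Category.assoc _ _ _).trans ((congrArg (m ≫ ·) hb).trans hm)
        · rw [WidePullbackCone.IsLimit.lift_π]
          exact (Category.assoc _ _ _).trans (hm' (some i))
    · have h3 : IsAffineHom (pullback.fst (p none) (WidePullbackCone.base t)) :=
        isAffineHom_pullback_fst _ _ h1
      exact inferInstanceAs (IsAffineHom (pullback.fst (p none) (WidePullbackCone.base t) ≫ p none))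

instance isAffineHom_widePullback_base (I : Type) [Finite I] {X : Scheme.{u}} (Y : I → Scheme.{u})
    (p : ∀ i, Y i ⟶ X) [hp : ∀ i, IsAffineHom (p i)] : IsAffineHom (WidePullback.base p) :=
  isAffineHom_widePullbackCone_base I Y p hp _ (limit.isLimit _)

section Algebra
variable {A R S T : Type*} [CommRing A] [CommRing R] [CommRing S] [CommRing T]

variable (A R S) in
/-- For `R → S` formally étale over `A`, the restriction map of vector fields (that is, functionals
on differentials); it is characterized by `D ↦ (dr ↦ D(dr))`. -/
noncomputable def dualMap [Algebra A R]
    [Algebra A S] [Algebra R S] [IsScalarTower A R S] [Algebra.FormallyEtale R S] :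
    Module.Dual R Ω[R⁄A] →ₗ[R] Module.Dual S Ω[S⁄A] :=
  IsBaseChange.linearMapLeftRightHom (KaehlerDifferential.isBaseChange_of_formallyEtale A R S)
    (Algebra.linearMap R S)

theorem dualMap_map [Algebra A R]
    [Algebra A S] [Algebra R S] [IsScalarTower A R S] [Algebra.FormallyEtale R S]
    (D : Module.Dual R Ω[R⁄A]) (w : Ω[R⁄A]) :
    dualMap A R S D (KaehlerDifferential.map A A R S w) = algebraMap R S (D w) :=
  IsBaseChange.linearMapLeftRightHom_comp_apply _ _ _ _

theorem dualMap_unique [Algebra A R]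
    [Algebra A S] [Algebra R S] [IsScalarTower A R S] [Algebra.FormallyEtale R S]
    (D : Module.Dual R Ω[R⁄A]) (E : Module.Dual S Ω[S⁄A])
    (h : ∀ w, E (KaehlerDifferential.map A A R S w) = algebraMap R S (D w)) :
    dualMap A R S D = E :=
  (KaehlerDifferential.isBaseChange_of_formallyEtale A R S).algHom_ext _ _ fun w ↦ by
    rw [dualMap_map, h]

variable (A R S) in
/-- The restriction map of symmetric algebras of vector fields. -/
noncomputable def symMap [Algebra A R]
    [Algebra A S] [Algebra R S] [IsScalarTower A R S] [Algebra.FormallyEtale R S] :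
    SymmetricAlgebra R (Module.Dual R Ω[R⁄A]) →ₐ[R] SymmetricAlgebra S (Module.Dual S Ω[S⁄A]) :=
  SymmetricAlgebra.lift ((SymmetricAlgebra.ι S _).restrictScalars R ∘ₗ dualMap A R S)

theorem symMap_ι [Algebra A R]
    [Algebra A S] [Algebra R S] [IsScalarTower A R S] [Algebra.FormallyEtale R S]
    (D : Module.Dual R Ω[R⁄A]) :
    symMap A R S (SymmetricAlgebra.ι _ _ D) = SymmetricAlgebra.ι _ _ (dualMap A R S D) := by
  simp [symMap]

theorem symMap_id [Algebra A R] :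
    symMap A R R = AlgHom.id _ _ := by
  ext D
  change symMap A R R (SymmetricAlgebra.ι R _ D) = SymmetricAlgebra.ι R _ D
  have hmap : KaehlerDifferential.map A A R R = LinearMap.id := by
    apply Derivation.liftKaehlerDifferential_unique
    ext r
    simp [KaehlerDifferential.map_D]
  rw [symMap_ι, dualMap_unique D D fun w ↦ by rw [hmap]; rfl]

theorem symMap_comp [Algebra A R]
    [Algebra A S] [Algebra R S] [IsScalarTower A R S] [Algebra.FormallyEtale R S]
    [Algebra A T] [Algebra R T] [Algebra S T] [IsScalarTower A R T] [IsScalarTower A S T]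
    [IsScalarTower R S T] [Algebra.FormallyEtale R T] [Algebra.FormallyEtale S T] (x) :
    symMap A S T (symMap A R S x) = symMap A R T x := by
  suffices h : ((symMap A S T).restrictScalars R).comp (symMap A R S) = symMap A R T from
    DFunLike.congr_fun h x
  ext D
  change symMap A S T (symMap A R S (SymmetricAlgebra.ι R _ D)) =
    symMap A R T (SymmetricAlgebra.ι R _ D)
  rw [symMap_ι, symMap_ι, symMap_ι, dualMap_unique D (dualMap A S T (dualMap A R S D))]
  intro w
  have : KaehlerDifferential.map A A R T w =
      KaehlerDifferential.map A A S T (KaehlerDifferential.map A A R S w) := by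
    have h : KaehlerDifferential.map A A R T =
        (KaehlerDifferential.map A A S T).restrictScalars R ∘ₗ
          KaehlerDifferential.map A A R S := by
      apply Derivation.liftKaehlerDifferential_unique
      ext r
      simp [KaehlerDifferential.map_D, ← IsScalarTower.algebraMap_apply]
    rw [h]; rfl
  rw [this, dualMap_map, dualMap_map, ← IsScalarTower.algebraMap_apply]

open SymmetricAlgebra in
theorem isLocalization_symMap [Algebra A R]
    [Algebra A S] [Algebra R S] [IsScalarTower A R S] [Algebra.FormallyEtale R S]
    (f : R) [IsLocalization.Away f S] [Module.FinitePresentation R Ω[R⁄A]] :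
    letI := (symMap A R S).toRingHom.toAlgebra
    IsLocalization.Away (algebraMap R (SymmetricAlgebra R (Module.Dual R Ω[R⁄A])) f)
      (SymmetricAlgebra S (Module.Dual S Ω[S⁄A])) := by
  set B := SymmetricAlgebra R (Module.Dual R Ω[R⁄A])
  set C := SymmetricAlgebra S (Module.Dual S Ω[S⁄A])
  let := (symMap A R S).toRingHom.toAlgebra
  have : IsScalarTower R B C := .of_algebraMap_eq' (symMap A R S).comp_algebraMap.symm
  have hdual : IsLocalizedModule (Submonoid.powers f) (dualMap A R S) := by
    have h2 : IsLocalizedModule (Submonoid.powers f) (Algebra.linearMap R S) := inferInstance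
    have := Module.FinitePresentation.isLocalizedModule_mapExtendScalars (Submonoid.powers f)
      (KaehlerDifferential.map A A R S) (Algebra.linearMap R S) S
    convert this using 1
    ext1 D
    refine dualMap_unique _ _ fun w ↦ ?_
    simp
  have hbc : IsBaseChange S (dualMap A R S) :=
    (isLocalizedModule_iff_isBaseChange (Submonoid.powers f) S _).mp hdual
  let Bf := Localization.Away (algebraMap R B f)
  let g : S →+* Bf := IsLocalization.Away.lift (S := S) f (g := (algebraMap B Bf).comp (algebraMap R B))
    (IsLocalization.Away.algebraMap_isUnit (algebraMap R B f))
  have hg : ∀ r, g (algebraMap R S r) = algebraMap B Bf (algebraMap R B r) := fun r ↦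
    IsLocalization.Away.lift_eq f (IsLocalization.Away.algebraMap_isUnit (algebraMap R B f)) r
  let := g.toAlgebra
  have : IsScalarTower R S Bf := .of_algebraMap_eq' <| by
    ext r
    exact ((hg r).trans (IsScalarTower.algebraMap_apply R B Bf r).symm).symm
  let inv : C →ₐ[S] Bf := SymmetricAlgebra.lift (hbc.lift
    ((IsScalarTower.toAlgHom R B Bf).toLinearMap ∘ₗ SymmetricAlgebra.ι R _))
  have hu : IsUnit ((algebraMap B C) (algebraMap R B f)) := by
    rw [← IsScalarTower.algebraMap_apply, IsScalarTower.algebraMap_apply R S C]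
    exact (IsLocalization.Away.algebraMap_isUnit f).map _
  let fwd : Bf →+* C := IsLocalization.Away.lift (algebraMap R B f) (g := algebraMap B C) hu
  have hfwd : ∀ b, fwd (algebraMap B Bf b) = algebraMap B C b := fun b ↦
    IsLocalization.Away.lift_eq _ hu b
  have hι : ∀ D, inv (SymmetricAlgebra.ι S _ (dualMap A R S D)) =
      algebraMap B Bf (SymmetricAlgebra.ι R _ D) := fun D ↦ by
    exact (SymmetricAlgebra.lift_ι_apply _ _).trans (hbc.lift_eq _ _)
  have h1 : ∀ b, inv (algebraMap B C b) = algebraMap B Bf b := by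
    intro b
    suffices h : (inv.restrictScalars R).comp (symMap A R S) = IsScalarTower.toAlgHom R B Bf from
      DFunLike.congr_fun h b
    ext D
    change inv (symMap A R S (SymmetricAlgebra.ι R _ D)) = algebraMap B Bf (SymmetricAlgebra.ι R _ D)
    rw [symMap_ι, hι]
  have h2 : ∀ c, fwd (inv c) = c := by
    have hS : ∀ s, fwd (algebraMap S Bf s) = algebraMap S C s := by
      intro s
      suffices h : fwd.comp (algebraMap S Bf) = algebraMap S C from DFunLike.congr_fun h s
      refine IsLocalization.ringHom_ext (Submonoid.powers f) ?_
      ext r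
      simp only [RingHom.comp_apply]
      rw [← IsScalarTower.algebraMap_apply, IsScalarTower.algebraMap_apply R B Bf, hfwd,
        ← IsScalarTower.algebraMap_apply, ← IsScalarTower.algebraMap_apply]
    let fwd' : Bf →ₐ[S] C := { fwd with commutes' := hS }
    intro c
    suffices h : fwd'.comp inv = AlgHom.id S C from DFunLike.congr_fun h c
    refine SymmetricAlgebra.algHom_ext (hbc.algHom_ext _ _ fun D ↦ ?_)
    change fwd (inv (SymmetricAlgebra.ι S _ (dualMap A R S D))) =
      SymmetricAlgebra.ι S _ (dualMap A R S D)
    rw [hι, hfwd]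
    exact symMap_ι D
  have h3 : ∀ x, inv (fwd x) = x := by
    intro x
    suffices h : inv.toRingHom.comp fwd = RingHom.id Bf from DFunLike.congr_fun h x
    refine IsLocalization.ringHom_ext (Submonoid.powers (algebraMap R B f)) ?_
    ext b
    change inv (fwd (algebraMap B Bf b)) = algebraMap B Bf b
    rw [hfwd, h1]
  exact IsLocalization.isLocalization_of_algEquiv (Submonoid.powers (algebraMap R B f))
    (AlgEquiv.ofRingEquiv (f := RingEquiv.ofRingHom fwd inv.toRingHom (RingHom.ext h2)
      (RingHom.ext h3)) hfwd)

/-- The functions on the cotangent bundle of `Spec R` over `Spec A`: the symmetric algebra of the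
module of vector fields `Hom_R(Ω_{R/A}, R)`. -/
abbrev CotangentAlgebra (φ : A →+* R) : Type _ :=
  letI := φ.toAlgebra
  SymmetricAlgebra R (Module.Dual R Ω[R⁄A])

/-- The restriction map of cotangent algebras along a formally étale `ψ : R →+* S` over `A`. -/
noncomputable def cotangentAlgebraMap (φ : A →+* R) (φ' : A →+* S) (ψ : R →+* S)
    (h : ψ.comp φ = φ') (hψ : ψ.FormallyEtale) : CotangentAlgebra φ →+* CotangentAlgebra φ' :=
  letI := φ.toAlgebra
  letI := φ'.toAlgebra
  letI := ψ.toAlgebra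
  haveI : IsScalarTower A R S := .of_algebraMap_eq' h.symm
  haveI : Algebra.FormallyEtale R S := hψ
  (symMap A R S).toRingHom

theorem cotangentAlgebraMap_algebraMap (φ : A →+* R) (φ' : A →+* S) (ψ : R →+* S)
    (h : ψ.comp φ = φ') (hψ : ψ.FormallyEtale) (r : R) :
    cotangentAlgebraMap φ φ' ψ h hψ (algebraMap R (CotangentAlgebra φ) r) =
      algebraMap S (CotangentAlgebra φ') (ψ r) := by
  let := φ.toAlgebra
  let := φ'.toAlgebra
  let := ψ.toAlgebra
  have : IsScalarTower A R S := .of_algebraMap_eq' h.symm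
  have : Algebra.FormallyEtale R S := hψ
  exact (symMap A R S).commutes r

theorem cotangentAlgebraMap_id (φ : A →+* R) (h) (hψ) :
    cotangentAlgebraMap φ φ (RingHom.id R) h hψ = RingHom.id (CotangentAlgebra φ) := by
  let := φ.toAlgebra
  exact congr(($(symMap_id (A := A) (R := R))).toRingHom)

theorem cotangentAlgebraMap_comp (φ : A →+* R) (φ' : A →+* S) (φ'' : A →+* T)
    (ψ : R →+* S) (ψ' : S →+* T) (ψ'' : R →+* T) (h) (hψ) (h') (hψ') (h'') (hψ'')
    (hc : ψ'.comp ψ = ψ'') :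
    (cotangentAlgebraMap φ' φ'' ψ' h' hψ').comp (cotangentAlgebraMap φ φ' ψ h hψ) =
      cotangentAlgebraMap φ φ'' ψ'' h'' hψ'' := by
  let := φ.toAlgebra
  let := φ'.toAlgebra
  let := φ''.toAlgebra
  let := ψ.toAlgebra
  let := ψ'.toAlgebra
  let := ψ''.toAlgebra
  have : IsScalarTower A R S := .of_algebraMap_eq' h.symm
  have : IsScalarTower A S T := .of_algebraMap_eq' h'.symm
  have : IsScalarTower A R T := .of_algebraMap_eq' h''.symm
  have : IsScalarTower R S T := .of_algebraMap_eq' hc.symm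
  have : Algebra.FormallyEtale R S := hψ
  have : Algebra.FormallyEtale S T := hψ'
  have : Algebra.FormallyEtale R T := hψ''
  exact RingHom.ext fun x ↦ symMap_comp (A := A) (R := R) (S := S) (T := T) x

theorem isLocalization_cotangentAlgebraMap (φ : A →+* R) (φ' : A →+* S) (ψ : R →+* S)
    (h : ψ.comp φ = φ') (hψ : ψ.FormallyEtale) (hφ : φ.Smooth) (f : R)
    (hf : letI := ψ.toAlgebra; IsLocalization.Away f S) :
    letI := (cotangentAlgebraMap φ φ' ψ h hψ).toAlgebra
    IsLocalization.Away (algebraMap R (CotangentAlgebra φ) f) (CotangentAlgebra φ') := by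
  let := φ.toAlgebra
  let := φ'.toAlgebra
  let := ψ.toAlgebra
  have : IsScalarTower A R S := .of_algebraMap_eq' h.symm
  have : Algebra.FormallyEtale R S := hψ
  have : Algebra.Smooth A R := hφ
  have : Module.FinitePresentation R Ω[R⁄A] := Module.finitePresentation_of_projective _ _
  exact isLocalization_symMap f
end Algebra

section Scheme
open Scheme AffineZariskiSite
variable {X : Scheme.{u}}

/-- The restriction `Γ(X, V) ⟶ Γ(X, U)` along an arrow of the affine Zariski site. -/
noncomputable abbrev restrictHom {U V : X.AffineZariskiSite} (i : U ⟶ V) :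
    Γ(X, V.toOpens) ⟶ Γ(X, U.toOpens) :=
  X.presheaf.map (homOfLE (toOpens_mono i.le)).op

theorem formallyEtale_restrictHom {U V : X.AffineZariskiSite} (i : U ⟶ V) :
    (restrictHom i).hom.FormallyEtale := by
  obtain ⟨r, hr⟩ := i.le
  obtain rfl : V.basicOpen r = U := Subtype.ext hr
  let : Algebra Γ(X, V.toOpens) Γ(X, (V.basicOpen r).toOpens) := (restrictHom i).hom.toAlgebra
  have : IsLocalization.Away r Γ(X, (V.basicOpen r).toOpens) := V.2.isLocalization_basicOpen r
  exact Algebra.FormallyEtale.of_isLocalization (Submonoid.powers r)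

variable {S : Scheme.{u}} (f : X ⟶ S)

/-- The ring homomorphism `Γ(S, ⊤) → Γ(X, U)`. -/
noncomputable abbrev structureHom (U : X.AffineZariskiSite) : Γ(S, ⊤) ⟶ Γ(X, U.toOpens) :=
  f.appLE ⊤ U.toOpens le_top

theorem restrictHom_comp_structureHom {U V : X.AffineZariskiSite} (i : U ⟶ V) :
    (restrictHom i).hom.comp (structureHom f V).hom = (structureHom f U).hom := by
  rw [← CommRingCat.hom_comp]
  exact congr(($(f.appLE_map (U := ⊤) le_top (homOfLE (toOpens_mono i.le)).op)).hom)

/-- The sheaf of algebras `U ↦ Sym Hom(Ω_{O(U)/O(S)}, O(U))` on the affine opens of `X`. -/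
noncomputable def cotangentDiagram :
    X.AffineZariskiSiteᵒᵖ ⥤ CommRingCat.{u} where
  obj U := .of (CotangentAlgebra (structureHom f U.unop).hom)
  map i := CommRingCat.ofHom (cotangentAlgebraMap _ _ (restrictHom i.unop).hom
      (restrictHom_comp_structureHom f i.unop) (formallyEtale_restrictHom i.unop))
  map_id U := by
    ext1
    have h : (restrictHom (𝟙 U.unop)).hom = RingHom.id Γ(X, U.unop.toOpens) := by
      rw [restrictHom, Subsingleton.elim (homOfLE _) (𝟙 _)]
      simp
    have key : ∀ (ψ : Γ(X, U.unop.toOpens) →+* Γ(X, U.unop.toOpens)) (h1) (h2),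
        ψ = RingHom.id _ → cotangentAlgebraMap (structureHom f U.unop).hom
          (structureHom f U.unop).hom ψ h1 h2 = RingHom.id _ := by
      rintro _ h1 h2 rfl
      exact cotangentAlgebraMap_id _ _ _
    exact key _ (restrictHom_comp_structureHom f (𝟙 U.unop)) (formallyEtale_restrictHom (𝟙 U.unop)) h
  map_comp {U V W} i j := by
    ext1
    refine (cotangentAlgebraMap_comp _ _ _ (restrictHom i.unop).hom (restrictHom j.unop).hom
      (restrictHom (i ≫ j).unop).hom
      (restrictHom_comp_structureHom f i.unop) (formallyEtale_restrictHom i.unop)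
      (restrictHom_comp_structureHom f j.unop) (formallyEtale_restrictHom j.unop)
      (restrictHom_comp_structureHom f (i ≫ j).unop) (formallyEtale_restrictHom (i ≫ j).unop)
      ?_).symm
    rw [← CommRingCat.hom_comp, ← X.presheaf.map_comp]
    rfl

/-- The structure map of the sheaf of algebras `cotangentDiagram`. -/
noncomputable def cotangentDiagramMap :
    (toOpensFunctor X).op ⋙ X.presheaf ⟶ cotangentDiagram f where
  app U := CommRingCat.ofHom (algebraMap Γ(X, U.unop.toOpens)
    (CotangentAlgebra (structureHom f U.unop).hom))
  naturality {U V} i := by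
    ext r
    exact (cotangentAlgebraMap_algebraMap _ _ (restrictHom i.unop).hom
      (restrictHom_comp_structureHom f i.unop) (formallyEtale_restrictHom i.unop) r).symm

theorem coequifibered_cotangentDiagramMap [IsAffine S] [Smooth f] :
    (cotangentDiagramMap f).Coequifibered := by
  refine coequifibered_iff_forall_isLocalizationAway.mpr fun U r ↦ ?_
  let i : U.basicOpen r ⟶ U := homOfLE (U.basicOpen_le r)
  exact isLocalization_cotangentAlgebraMap _ _ (restrictHom i).hom
    (restrictHom_comp_structureHom f i) (formallyEtale_restrictHom i)
    (f.smooth_appLE (isAffineOpen_top S) U.2 le_top) r (U.2.isLocalization_basicOpen r)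

/-- The cotangent bundle `T*_X → X` of a smooth scheme over an affine base, as the relative
spectrum over `X` of the symmetric algebra of the sheaf of vector fields `Hom(Ω_X, O_X)`.
Its sections are the differential `1`-forms. -/
noncomputable def CotangentBundle [IsAffine S] [Smooth f] : Scheme.{u} :=
  RelSpec (coequifibered_cotangentDiagramMap f)

/-- The projection of the cotangent bundle. -/
noncomputable def CotangentBundle.toBase [IsAffine S] [Smooth f] : CotangentBundle f ⟶ X :=
  RelSpec.toBase (coequifibered_cotangentDiagramMap f)

instance CotangentBundle.isAffineHom_toBase [IsAffine S] [Smooth f] :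
    IsAffineHom (CotangentBundle.toBase f) :=
  RelSpec.isAffineHom_toBase (coequifibered_cotangentDiagramMap f)
end Scheme

section Quotient
open Scheme AffineZariskiSite
variable {X Y : Scheme.{u}} (π : Y ⟶ X) {G : Type*} (σ : G → (Y ⟶ Y)) (hσ : ∀ g, σ g ≫ π = π)

theorem preimage_le_of_comp_eq (g : Y ⟶ Y) (hg : g ≫ π = π) (U : X.Opens) :
    π ⁻¹ᵁ U ≤ g ⁻¹ᵁ π ⁻¹ᵁ U := by
  rw [← Scheme.Hom.comp_preimage, hg]

/-- The functions on `π⁻¹(U)` that are fixed by all the automorphisms `σ g` of `Y` over `X`. -/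
noncomputable def invariants (U : X.Opens) : Subring Γ(Y, π ⁻¹ᵁ U) :=
  ⨅ g, RingHom.eqLocus
    ((σ g).appLE (π ⁻¹ᵁ U) (π ⁻¹ᵁ U) (preimage_le_of_comp_eq π (σ g) (hσ g) U)).hom (RingHom.id _)

theorem mem_invariants {U : X.Opens} {s : Γ(Y, π ⁻¹ᵁ U)} :
    s ∈ invariants π σ hσ U ↔ ∀ g, (σ g).appLE (π ⁻¹ᵁ U) (π ⁻¹ᵁ U)
      (preimage_le_of_comp_eq π (σ g) (hσ g) U) s = s := by
  simp only [invariants, Subring.mem_iInf]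
  rfl

theorem map_mem_invariants {U V : X.Opens} (i : U ≤ V) {s : Γ(Y, π ⁻¹ᵁ V)}
    (hs : s ∈ invariants π σ hσ V) :
    Y.presheaf.map (homOfLE (π.preimage_mono i)).op s ∈ invariants π σ hσ U := by
  rw [mem_invariants] at hs ⊢
  intro g
  have key : (σ g).appLE (π ⁻¹ᵁ V) (π ⁻¹ᵁ V) (preimage_le_of_comp_eq π (σ g) (hσ g) V) ≫
      Y.presheaf.map (homOfLE (π.preimage_mono i)).op =
      Y.presheaf.map (homOfLE (π.preimage_mono i)).op ≫
        (σ g).appLE (π ⁻¹ᵁ U) (π ⁻¹ᵁ U) (preimage_le_of_comp_eq π (σ g) (hσ g) U) := by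
    rw [Scheme.Hom.appLE_map, Scheme.Hom.map_appLE]
  have h := congr($(key) s)
  simp only [CommRingCat.comp_apply] at h
  rw [← h, hs g]

theorem app_mem_invariants {U : X.Opens} (r : Γ(X, U)) : π.app U r ∈ invariants π σ hσ U := by
  rw [mem_invariants]
  intro g
  have key : π.app U ≫ (σ g).appLE (π ⁻¹ᵁ U) (π ⁻¹ᵁ U)
      (preimage_le_of_comp_eq π (σ g) (hσ g) U) = π.app U := by
    rw [Scheme.Hom.app_eq_appLE, Scheme.Hom.appLE_comp_appLE]
    simp only [hσ]
  exact congr($(key) r)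

/-- The sheaf of algebras `(π_* O_Y)^G` on the affine opens of `X`. -/
noncomputable def invariantsDiagram : X.AffineZariskiSiteᵒᵖ ⥤ CommRingCat.{u} where
  obj U := .of (invariants π σ hσ U.unop.toOpens)
  map {V U} i := CommRingCat.ofHom
    ((Y.presheaf.map (homOfLE (π.preimage_mono (toOpens_mono i.unop.le))).op).hom.restrict _ _
      fun _ hs ↦ map_mem_invariants π σ hσ (toOpens_mono i.unop.le) hs)
  map_id U := by
    ext s
    exact congr($(Y.presheaf.map_id _) s.1)
  map_comp i j := by
    ext s
    have key := Y.presheaf.map_comp (homOfLE (π.preimage_mono (toOpens_mono i.unop.le))).op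
      (homOfLE (π.preimage_mono (toOpens_mono j.unop.le))).op
    exact congr($key s.1)

/-- The structure map of the sheaf of algebras `(π_* O_Y)^G`. -/
noncomputable def invariantsDiagramMap :
    (toOpensFunctor X).op ⋙ X.presheaf ⟶ invariantsDiagram π σ hσ where
  app U := CommRingCat.ofHom ((π.app U.unop.toOpens).hom.codRestrict _
    (app_mem_invariants π σ hσ))
  naturality {V U} i := by
    ext s
    exact Subtype.ext congr($(π.naturality ((toOpensFunctor X).op.map i)) s)

theorem isLocalization_invariants_aux {A B R : Type*} [CommRing A] [CommRing B] [CommRing R]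
    [Finite G] (ρ : A →+* B) (t : A) (hloc : @IsLocalization.Away A _ t B _ ρ.toAlgebra)
    (τ : G → A →+* A) (τ' : G → B →+* B) (hτ : ∀ g a, ρ (τ g a) = τ' g (ρ a))
    (ht : ∀ g, τ g t = t) (A' : Subring A) (B' : Subring B) (hA : ∀ a, a ∈ A' ↔ ∀ g, τ g a = a)
    (hB : ∀ b, b ∈ B' ↔ ∀ g, τ' g b = b) (ρ' : A' →+* B') (hρ' : ∀ a, (ρ' a : B) = ρ a) (t' : A')
    (ht' : (t' : A) = t) : @IsLocalization.Away A' _ t' B' _ ρ'.toAlgebra := by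
  subst ht'
  let := ρ.toAlgebra
  let := ρ'.toAlgebra
  have hρa : ∀ a, algebraMap A B a = ρ a := fun a ↦ rfl
  have hu : IsUnit (ρ t') := IsLocalization.Away.algebraMap_isUnit (S := B) (t' : A)
  obtain ⟨v, hv⟩ := hu.exists_right_inv
  have hvB : v ∈ B' := by
    refine (hB v).2 fun g ↦ hu.mul_left_cancel ?_
    rw [hv]
    have := congr(τ' g $hv)
    rwa [map_mul, map_one, ← hτ, ht] at this
  refine ⟨?_, ?_, ?_⟩
  · rintro ⟨_, n, rfl⟩
    change IsUnit (ρ' (t' ^ n))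
    rw [map_pow]
    refine IsUnit.pow _ (.of_mul_eq_one ⟨v, hvB⟩ (Subtype.ext ?_))
    change (ρ' t' : B) * v = 1
    rw [hρ', hv]
  · intro b
    obtain ⟨⟨a, _, n, rfl⟩, h⟩ := IsLocalization.surj (Submonoid.powers (t' : A)) (b : B)
    replace h : (b : B) * ρ (t' : A) ^ n = ρ a := by rw [← map_pow]; exact h
    have h1 : ∀ g, ∃ m, (t' : A) ^ m * τ g a = t' ^ m * a := by
      intro g
      have : algebraMap A B (τ g a) = algebraMap A B a := by
        rw [hρa, hρa, hτ, ← h, map_mul, map_pow, ← hτ, ht, (hB _).1 b.2]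
      obtain ⟨⟨_, m, rfl⟩, hc⟩ := IsLocalization.exists_of_eq (M := Submonoid.powers (t' : A)) this
      exact ⟨m, hc⟩
    choose m hm using h1
    have := Fintype.ofFinite G
    let M := ∑ g, m g
    have hmem : (t' : A) ^ M * a ∈ A' := by
      refine (hA _).2 fun g ↦ ?_
      rw [map_mul, map_pow, ht]
      obtain ⟨c, hc⟩ := Nat.exists_eq_add_of_le
        (Finset.single_le_sum (fun _ _ ↦ Nat.zero_le _) (Finset.mem_univ g) : m g ≤ M)
      rw [show M = m g + c from hc, add_comm, pow_add, mul_assoc, mul_assoc, hm]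
    refine ⟨⟨⟨_, hmem⟩, ⟨t' ^ (n + M), n + M, rfl⟩⟩, Subtype.ext ?_⟩
    change (b : B) * (ρ' (t' ^ (n + M)) : B) = (ρ' ⟨_, hmem⟩ : B)
    rw [hρ', hρ']
    simp only [SubmonoidClass.coe_pow, map_mul, map_pow, ← h]
    ring
  · intro x y h
    have h' : algebraMap A B x = algebraMap A B y := by
      rw [hρa, hρa, ← hρ', ← hρ']
      exact congr(($h).1)
    obtain ⟨⟨_, m, rfl⟩, hc⟩ := IsLocalization.exists_of_eq (M := Submonoid.powers (t' : A)) h'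
    exact ⟨⟨_, m, rfl⟩, Subtype.ext hc⟩

theorem isLocalization_map_preimage_basicOpen [QuasiCompact π] [QuasiSeparated π]
    {U : X.Opens} (hU : IsAffineOpen U) (r : Γ(X, U)) (V : X.Opens) (hV : V = X.basicOpen r)
    (i : π ⁻¹ᵁ V ≤ π ⁻¹ᵁ U) :
    @IsLocalization.Away Γ(Y, π ⁻¹ᵁ U) _ (π.app U r) Γ(Y, π ⁻¹ᵁ V) _
      (Y.presheaf.map (homOfLE i).op).hom.toAlgebra := by
  have key : ∀ (W : Y.Opens) (hW : W = Y.basicOpen (π.app U r)) (j : W ≤ π ⁻¹ᵁ U),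
      @IsLocalization.Away Γ(Y, π ⁻¹ᵁ U) _ (π.app U r) Γ(Y, W) _
        (Y.presheaf.map (homOfLE j).op).hom.toAlgebra := by
    rintro _ rfl j
    exact isLocalization_basicOpen_of_qcqs (π.isCompact_preimage hU.isCompact)
      (π.isQuasiSeparated_preimage hU.isQuasiSeparated) (π.app U r)
  exact key _ (hV ▸ Scheme.preimage_basicOpen π r) i

theorem coequifibered_invariantsDiagramMap [Finite G] [QuasiCompact π] [QuasiSeparated π] :
    (invariantsDiagramMap π σ hσ).Coequifibered := by
  refine coequifibered_iff_forall_isLocalizationAway.mpr fun U r ↦ ?_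
  have i : (U.basicOpen r).toOpens ≤ U.toOpens := X.basicOpen_le r
  refine isLocalization_invariants_aux (R := Γ(X, U.1)) (G := G)
    (Y.presheaf.map (homOfLE (π.preimage_mono i)).op).hom (π.app U.1 r)
    (isLocalization_map_preimage_basicOpen π U.2 r _ rfl _)
    (fun g ↦ ((σ g).appLE (π ⁻¹ᵁ U.1) (π ⁻¹ᵁ U.1) (preimage_le_of_comp_eq π (σ g) (hσ g) _)).hom)
    (fun g ↦ ((σ g).appLE (π ⁻¹ᵁ (U.basicOpen r).1) (π ⁻¹ᵁ (U.basicOpen r).1)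
      (preimage_le_of_comp_eq π (σ g) (hσ g) _)).hom)
    (fun g a ↦ ?_) (fun g ↦ (mem_invariants π σ hσ).1 (app_mem_invariants π σ hσ r) g)
    (invariants π σ hσ U.1) (invariants π σ hσ (U.basicOpen r).1)
    (fun a ↦ mem_invariants π σ hσ) (fun a ↦ mem_invariants π σ hσ) _ (fun a ↦ rfl) _ rfl
  have key : (σ g).appLE (π ⁻¹ᵁ U.1) (π ⁻¹ᵁ U.1) (preimage_le_of_comp_eq π (σ g) (hσ g) _) ≫
      Y.presheaf.map (homOfLE (π.preimage_mono i)).op =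
      Y.presheaf.map (homOfLE (π.preimage_mono i)).op ≫
        (σ g).appLE (π ⁻¹ᵁ (U.basicOpen r).1) (π ⁻¹ᵁ (U.basicOpen r).1)
          (preimage_le_of_comp_eq π (σ g) (hσ g) _) := by
    rw [Scheme.Hom.appLE_map, Scheme.Hom.map_appLE]
  exact congr($key a)

theorem invariantsDiagram_map_subtype {U V : X.AffineZariskiSite} (i : U ⟶ V) :
    (invariantsDiagram π σ hσ).map i.op ≫ CommRingCat.ofHom (invariants π σ hσ U.1).subtype =
      CommRingCat.ofHom (invariants π σ hσ V.1).subtype ≫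
        Y.presheaf.map (homOfLE (π.preimage_mono (toOpens_mono i.le))).op := by
  ext s
  rfl

/-- The quotient `Y / G` of a scheme `Y` that is affine over `X` by a finite group `G` of automorphisms
of `Y` over `X`: the relative spectrum over `X` of `(π_* O_Y)^G`. -/
noncomputable def FiniteQuotient [Finite G] [IsAffineHom π] : Scheme.{u} :=
  RelSpec (coequifibered_invariantsDiagramMap π σ hσ)

/-- The morphism `Y / G ⟶ X`. -/
noncomputable def FiniteQuotient.toBase [Finite G] [IsAffineHom π] : FiniteQuotient π σ hσ ⟶ X :=
  RelSpec.toBase (coequifibered_invariantsDiagramMap π σ hσ)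

/-- The quotient morphism `Y ⟶ Y / G`. -/
noncomputable def FiniteQuotient.mk [Finite G] [IsAffineHom π] : Y ⟶ FiniteQuotient π σ hσ :=
  RelSpec.lift (coequifibered_invariantsDiagramMap π σ hσ) π
    (fun U ↦ CommRingCat.ofHom (invariants π σ hσ U.1).subtype) (invariantsDiagram_map_subtype π σ hσ)

theorem FiniteQuotient.mk_toBase [Finite G] [IsAffineHom π] :
    FiniteQuotient.mk π σ hσ ≫ FiniteQuotient.toBase π σ hσ = π :=
  RelSpec.lift_toBase _ _ _ (invariantsDiagram_map_subtype π σ hσ) fun U ↦ by ext s; rfl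

end Quotient

section Chow
variable {S X : Scheme.{u}} (f : X ⟶ S) [IsAffine S] [Smooth f]

/-- The fibre power `T*_X ×_X ⋯ ×_X T*_X` with factors indexed by a finite type `I`. -/
noncomputable def CotangentPower (I : Type) [Finite I] : Scheme.{u} :=
  widePullback X (fun _ : I ↦ CotangentBundle f) fun _ ↦ CotangentBundle.toBase f

namespace CotangentPower
variable (I J K : Type) [Finite I] [Finite J] [Finite K]

/-- The projection of the fibre power to `X`. -/
noncomputable def toBase : CotangentPower f I ⟶ X :=
  WidePullback.base fun _ : I ↦ CotangentBundle.toBase f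

instance : IsAffineHom (toBase f I) :=
  isAffineHom_widePullback_base I _ _

variable {I J K}

/-- The projection of the fibre power to the factor with index `i`. -/
noncomputable def proj (i : I) : CotangentPower f I ⟶ CotangentBundle f :=
  WidePullback.π (fun _ : I ↦ CotangentBundle.toBase f) i

/-- The morphism `(z_j)_{j ∈ J} ↦ (z_{r(i)})_{i ∈ I}` of fibre powers. -/
noncomputable def reindex (r : I → J) : CotangentPower f J ⟶ CotangentPower f I :=
  WidePullback.lift (toBase f J) (fun i ↦ proj f (r i)) fun i ↦
    WidePullback.π_arrow (fun _ : J ↦ CotangentBundle.toBase f) (r i)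

theorem reindex_toBase (r : I → J) : reindex f r ≫ toBase f I = toBase f J :=
  WidePullback.lift_base _ _ _ _

theorem reindex_proj (r : I → J) (i : I) : reindex f r ≫ proj f i = proj f (r i) :=
  WidePullback.lift_π _ _ _ _ _

end CotangentPower

/-- The relative Chow scheme `Chow^n(T*_X/X) = (T*_X ×_X ⋯ ×_X T*_X) / S_n`, the quotient of the `n`-fold
fibre power by the permutations of its factors. -/
noncomputable def Chow (n : ℕ) : Scheme.{u} :=
  FiniteQuotient (CotangentPower.toBase f (Fin n))
    (fun g : Equiv.Perm (Fin n) ↦ CotangentPower.reindex f g)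
    fun g ↦ CotangentPower.reindex_toBase f g

namespace Chow

/-- The projection `Chow^n(T*_X/X) ⟶ X`. -/
noncomputable def toBase (n : ℕ) : Chow f n ⟶ X :=
  FiniteQuotient.toBase (CotangentPower.toBase f (Fin n))
    (fun g : Equiv.Perm (Fin n) ↦ CotangentPower.reindex f g)
    fun g ↦ CotangentPower.reindex_toBase f g

/-- The quotient morphism `(z_1, …, z_n) ↦ z_1 + ⋯ + z_n` to the Chow scheme. -/
noncomputable def mk (n : ℕ) : CotangentPower f (Fin n) ⟶ Chow f n :=
  FiniteQuotient.mk (CotangentPower.toBase f (Fin n))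
    (fun g : Equiv.Perm (Fin n) ↦ CotangentPower.reindex f g)
    fun g ↦ CotangentPower.reindex_toBase f g

theorem mk_toBase (n : ℕ) : mk f n ≫ toBase f n = CotangentPower.toBase f (Fin n) :=
  FiniteQuotient.mk_toBase _ _ _

variable {f} in
/-- For a point `p = (z_1, …, z_n)` of the fibre power, with `z_i` the induced points of `T*_X` with values
in the residue field of `p`, the equivalence relation `z_i = z_j` on the indices. -/
noncomputable def coincidence {n : ℕ} (p : CotangentPower f (Fin n)) : Setoid (Fin n) :=
  Setoid.ker fun i ↦ (CotangentPower f (Fin n)).fromSpecResidueField p ≫ CotangentPower.proj f i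

/-- The stratum `Chow^n_μ(T*_X/X)`, `μ = (1^{α_1}, …, s^{α_s})`: the cycles `z_1 + ⋯ + z_n` in which, for
each `j`, exactly `α_j` points have multiplicity `j`, and no point has multiplicity above `s`.
The index `j : Fin s` stands for the part `j + 1` of the partition. -/
noncomputable def stratum (n : ℕ) {s : ℕ} (α : Fin s → ℕ) : Set (Chow f n) :=
  mk f n '' {p | (∀ c ∈ (coincidence p).classes, c.ncard ≤ s) ∧
    ∀ j : Fin s, {c ∈ (coincidence p).classes | c.ncard = (j : ℕ) + 1}.ncard = α j}

/-- The stratum `Chow^m_{(1^m)}(T*_X/X)` of reduced cycles. -/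
noncomputable def reducedStratum (m : ℕ) : Set (Chow f m) :=
  stratum f m fun _ : Fin 1 ↦ m

/-- The fibre product over `X` of the schemes `Chow^{α_j}(T*_X/X)`. -/
noncomputable def prod {s : ℕ} (α : Fin s → ℕ) : Scheme.{u} :=
  widePullback X (fun j ↦ Chow f (α j)) fun j ↦ toBase f (α j)

/-- The morphism that sends a family of points `z_{j,m}` of `T*_X`, `1 ≤ m ≤ α_j`, to the tuple of
cycles `(∑_m z_{j,m})_j`. -/
noncomputable def prodMk {s : ℕ} (α : Fin s → ℕ) :
    CotangentPower f (Σ j : Fin s, Fin (α j)) ⟶ prod f α :=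
  WidePullback.lift (CotangentPower.toBase f _)
    (fun j ↦ CotangentPower.reindex f (Sigma.mk j) ≫ mk f (α j)) fun j ↦ by
      rw [Category.assoc, mk_toBase, CotangentPower.reindex_toBase]

/-- `τ` is the morphism `(c_1, …, c_s) ↦ c_1 + 2 c_2 + ⋯ + s c_s` of schemes over `X`: it sends the tuple of
the cycles `c_j = ∑_m z_{j,m}` to the cycle of the points in which each `z_{j,m}` is repeated `j` times.
The part `j` of the partition has the index `j - 1` in `Fin s`. -/
def IsWeightedSum {n s : ℕ} {α : Fin s → ℕ} (τ : prod f α ⟶ Chow f n) : Prop :=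
  τ ≫ toBase f n = WidePullback.base (fun j ↦ toBase f (α j)) ∧
    ∀ r : Fin n → Σ j : Fin s, Fin (α j), (∀ x, (r ⁻¹' {x}).ncard = (x.1 : ℕ) + 1) →
      prodMk f α ≫ τ = CotangentPower.reindex f r ≫ mk f n

end Chow

/-- A spectral datum of degree `n`: a section of `Chow^n(T*_X/X) ⟶ X`. -/
structure SpectralDatum (n : ℕ) where
  /-- the underlying morphism -/
  hom : X ⟶ Chow f n
  hom_toBase : hom ≫ Chow.toBase f n = 𝟙 X

/-- The section `(a_1, …, a_s)` of the fibre product of the `Chow^{α_j}(T*_X/X)`. -/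
noncomputable def SpectralDatum.tuple {s : ℕ} {α : Fin s → ℕ} (a : ∀ j, SpectralDatum f (α j)) :
    X ⟶ Chow.prod f α :=
  WidePullback.lift (𝟙 X) (fun j ↦ (a j).hom) fun j ↦ (a j).hom_toBase
end Chow

/-- Projective space of dimension `N` over a field. -/
noncomputable def projectiveSpace (k : Type u) [Field k] (N : ℕ) : Scheme.{u} :=
  letI : GradedAlgebra (MvPolynomial.homogeneousSubmodule (Fin (N + 1)) k) :=
    MvPolynomial.gradedAlgebra
  Proj (MvPolynomial.homogeneousSubmodule (Fin (N + 1)) k)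

/-- The structure morphism of projective space. -/
noncomputable def projectiveSpace.toSpec (k : Type u) [Field k] (N : ℕ) :
    projectiveSpace k N ⟶ Spec (.of k) :=
  letI : GradedAlgebra (MvPolynomial.homogeneousSubmodule (Fin (N + 1)) k) :=
    MvPolynomial.gradedAlgebra
  Proj.toSpecZero (MvPolynomial.homogeneousSubmodule (Fin (N + 1)) k) ≫
    Spec.map (CommRingCat.ofHom
      (algebraMap k (MvPolynomial.homogeneousSubmodule (Fin (N + 1)) k 0)))

/-- A `k`-scheme is projective if it is a closed subscheme of some projective space over `k`. -/
def IsProjective {k : Type u} [Field k] {X : Scheme.{u}} (f : X ⟶ Spec (.of k)) : Prop :=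
  ∃ (N : ℕ) (i : X ⟶ projectiveSpace k N),
    IsClosedImmersion i ∧ i ≫ projectiveSpace.toSpec k N = f

end SpectralData

/-! Let `K` be the function field of `X` and `L` an algebraic closure of `K`. At the geometric
generic point, `a` becomes a cycle `z_1 + ⋯ + z_n` of `L`-points of `T*_X`. The stratum condition
says that exactly `α_j` distinct points occur with multiplicity `j`; let `c_j` be the sum of these
points, each taken once. Then `a = ∑ j c_j` over `L`, and it remains to extend each `c_j` to a
section over `X`.

The Galois group of `L/K` fixes the cycle `a`, so it permutes the `z_i` and preserves their
multiplicities; hence it fixes every `c_j`. In characteristic zero the coordinates of `c_j`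
therefore lie in `K`. They are also integral over the functions on any affine open of `X` containing
the generic point: functions on the fibre power are integral over the `S_n`-invariants, and the
invariants take values in `O_X` along `a`. Since `X` is smooth it is normal, so these coordinates
are regular and `c_j` extends to a spectral datum `a_j` (`mem_range_geomEval`,
`exists_spectralDatum_part`). The equation `a = τ ∘ (a_1, …, a_s)` holds at the geometric generic
point, hence everywhere, as `X` is integral and the Chow scheme is separated over `X`. The image of
`a_j` lies in the closure of the stratum because the generic point maps into the stratum.

Two points need care. The morphism `τ` is defined on a product of quotients, which has to be
recognized as the quotient of the big fibre power by `∏ S_{α_j}`; tensor products of averaging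
operators do this, since the group orders are invertible (`injective_and_mem_range_of_invariants`,
`exists_isWeightedSum`). The stratum is defined through residue fields of points of the fibre power,
and such a point has to be replaced by an `L`-point with the same coincidences
(`exists_geomPoint_lift`). That two `L`-points with the same cycle differ by a permutation is
`exists_reindex_of_mk_eq`. -/

namespace SpectralData

/-! ### Commutative algebra: normality of smooth algebras, invariants of finite groups. -/

section Rings
open TensorProduct

/-- Integral closure commutes with smooth base change, so the integral closure of `S` in `S ⊗[R] K`
comes from that of `R` in `K`, which is `R`. The ring `S ⊗[R] K` is the fraction field of `S`, being
a domain that is finite over `K`. -/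
theorem isIntegrallyClosed_of_etale (R S : Type*) [CommRing R] [CommRing S] [IsDomain R]
    [IsIntegrallyClosed R] [IsDomain S] [Algebra R S] [Algebra.Etale R S] :
    IsIntegrallyClosed S := by
  let K := FractionRing R
  have hle : Algebra.algebraMapSubmonoid S (nonZeroDivisors R) ≤ nonZeroDivisors S := by
    rintro _ ⟨r, hr, rfl⟩
    exact mem_nonZeroDivisors_of_ne_zero fun h ↦ nonZeroDivisors.ne_zero hr
      (FaithfulSMul.algebraMap_injective R S (h.trans (map_zero _).symm))
  have hloc : IsLocalization (Algebra.algebraMapSubmonoid S (nonZeroDivisors R)) (S ⊗[R] K) :=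
    inferInstance
  have : IsDomain (S ⊗[R] K) :=
    IsLocalization.isDomain_of_le_nonZeroDivisors (R := S) (S ⊗[R] K) hle
  have : IsDomain (K ⊗[R] S) := (Algebra.TensorProduct.comm R K S).toMulEquiv.isDomain _
  have : Module.Finite K (K ⊗[R] S) := Algebra.FormallyUnramified.finite_of_free _ _
  have hf : IsField (S ⊗[R] K) := (Algebra.TensorProduct.comm R S K).toMulEquiv.isField
    (isField_of_isIntegral_of_isField' (Field.toIsField K))
  have hinj : Function.Injective (algebraMap S (S ⊗[R] K)) := IsLocalization.injective _ hle
  -- Inverting the nonzero elements of `R` already inverts every nonzero `s : S`: clearing the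
  -- denominator of `s⁻¹` shows that `s` divides the image of a nonzero element of `R`.
  have hfrac : IsFractionRing S (S ⊗[R] K) := by
    refine IsLocalization.of_le_of_exists_dvd _ (nonZeroDivisors S) hle fun s hs ↦ ?_
    obtain ⟨t, ht⟩ := hf.mul_inv_cancel
      ((map_ne_zero_iff _ hinj).2 (nonZeroDivisors.ne_zero hs))
    obtain ⟨⟨y, m⟩, hy⟩ :=
      IsLocalization.surj (Algebra.algebraMapSubmonoid S (nonZeroDivisors R)) t
    refine ⟨m, m.2, y, hinj ?_⟩
    rw [map_mul, ← hy, ← mul_assoc, ht, one_mul]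
  rw [isIntegrallyClosed_iff (S ⊗[R] K)]
  intro x hx
  obtain ⟨y, hy⟩ := (TensorProduct.toIntegralClosure_bijective_of_smooth (R := R) (S := S)
    (B := K)).2 ⟨x, hx⟩
  obtain rfl : ((toIntegralClosure R S K y : integralClosure S (S ⊗[R] K)) : S ⊗[R] K) = x :=
    congr_arg Subtype.val hy
  clear hy hx
  induction y with
  | zero => exact ⟨0, by simp⟩
  | add y z hy hz =>
    obtain ⟨a, ha⟩ := hy
    obtain ⟨b, hb⟩ := hz
    exact ⟨a + b, by rw [map_add, ha, hb, map_add]; rfl⟩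
  | tmul s t =>
    obtain ⟨r, hr⟩ := IsIntegrallyClosed.isIntegral_iff.mp t.2
    refine ⟨s * algebraMap R S r, ?_⟩
    change _ = s ⊗ₜ[R] (t : K)
    rw [← hr, Algebra.TensorProduct.algebraMap_apply, Algebra.algebraMap_eq_smul_one (A := K),
      ← smul_tmul, Algebra.smul_def, mul_comm s]
    rfl

/-- Normality may be checked at maximal ideals, and near each of them a smooth algebra is étale over
a polynomial ring, which is normal. -/
theorem isIntegrallyClosed_of_smooth (k S : Type*) [Field k] [CommRing S] [IsDomain S]
    [Algebra k S] [Algebra.Smooth k S] : IsIntegrallyClosed S := by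
  refine .of_localization_maximal fun p _ _ ↦ ?_
  obtain ⟨f, hf, n, _, _, _⟩ := Algebra.IsSmoothAt.exists_isStandardEtale_mvPolynomial
    (R := k) (p := p)
  have hf' : Submonoid.powers f ≤ p.primeCompl := Submonoid.powers_le.mpr hf
  have : IsDomain (Localization.Away f) :=
    IsLocalization.isDomain_of_le_nonZeroDivisors (R := S) _ (hf'.trans p.primeCompl_le_nonZeroDivisors)
  have := isIntegrallyClosed_of_etale (MvPolynomial (Fin n) k) (Localization.Away f)
  let := (IsLocalization.map (M := Submonoid.powers f) (T := p.primeCompl) (Localization.AtPrime p)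
    (S := Localization.Away f) (RingHom.id S) hf').toAlgebra
  have : IsScalarTower S (Localization.Away f) (Localization.AtPrime p) :=
    .of_algebraMap_eq' (IsLocalization.map_comp (M := Submonoid.powers f) _).symm
  have := IsLocalization.isLocalization_of_submonoid_le (Localization.Away f)
    (Localization.AtPrime p) (Submonoid.powers f) p.primeCompl hf'
  refine isIntegrallyClosed_of_isLocalization (R := Localization.Away f) _
    (p.primeCompl.map (algebraMap S (Localization.Away f))) ?_
  rintro _ ⟨s, hs, rfl⟩
  exact mem_nonZeroDivisors_of_ne_zero fun h ↦ p.primeCompl_le_nonZeroDivisors hs |> fun hs ↦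
    nonZeroDivisors.ne_zero hs (IsLocalization.injective (Localization.Away f)
      (hf'.trans p.primeCompl_le_nonZeroDivisors) (h.trans (map_zero _).symm))

variable {D L k : Type*} [CommRing D] [Field L] [Field k] {G : Type*} [Finite G]

/-- If `ψ` differs from every `φ ∘ τ g`, each locus where they agree is a proper `k`-subspace of
`D`. As `k` is infinite, some `d` avoids them all. But `∏ (X - τ g d)` has invariant coefficients,
so `φ` and `ψ` give it the same image; its root `ψ d` must then be some `φ (τ g d)`. The group
structure on `G` enters only through the translations `e` and the identity `g₁`. -/
theorem exists_eq_comp_of_eqOn_invariants [Infinite k] (c : k →+* D) (τ : G → D →+* D)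
    (e : G → Equiv.Perm G) (he : ∀ g h x, τ g (τ h x) = τ (e g h) x) (g₁ : G)
    (hg₁ : ∀ x, τ g₁ x = x) (hc : ∀ g t, τ g (c t) = c t) (φ ψ : D →+* L)
    (h : ∀ x, (∀ g, τ g x = x) → φ x = ψ x) : ∃ g, ψ = φ.comp (τ g) := by
  by_contra! H
  have := Fintype.ofFinite G
  let := c.toAlgebra
  let := (φ.comp c).toAlgebra
  have hψ : ∀ t, ψ (c t) = φ (c t) := fun t ↦ (h _ (hc · t)).symm
  let V (g : G) : Subspace k D := LinearMap.ker
    ({ toFun := fun x ↦ ψ x - φ (τ g x)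
       map_add' := fun x y ↦ by simp only [map_add]; ring
       map_smul' := fun t x ↦ by
        have h1 (a : L) : t • a = φ (c t) * a := rfl
        have h2 (a : D) : t • a = c t * a := rfl
        rw [RingHom.id_apply, h1, h2, map_mul, map_mul, map_mul, hc, hψ]; ring } : D →ₗ[k] L)
  have hV : ∀ g x, x ∈ V g ↔ ψ x = φ (τ g x) := fun g x ↦ by
    rw [LinearMap.mem_ker]; exact sub_eq_zero
  classical
  have hne : ⋃ p ∈ Finset.univ.image V, (p : Set D) ≠ Set.univ := by
    refine Subspace.biUnion_ne_univ_of_top_notMem fun hmem ↦ ?_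
    obtain ⟨g, -, hg⟩ := Finset.mem_image.mp hmem
    exact H g (RingHom.ext fun x ↦ (hV g x).1 (hg ▸ Submodule.mem_top))
  obtain ⟨d, hd⟩ := (Set.ne_univ_iff_exists_notMem _).mp hne
  have hd' : ∀ g, ψ d ≠ φ (τ g d) := fun g hg ↦ hd <| Set.mem_biUnion
    (Finset.mem_coe.2 (Finset.mem_image_of_mem V (Finset.mem_univ g))) ((hV g d).2 hg)
  let P : Polynomial D := ∏ g, (Polynomial.X - Polynomial.C (τ g d))
  have hP : P.map φ = P.map ψ := by
    ext i
    rw [Polynomial.coeff_map, Polynomial.coeff_map]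
    refine h _ fun g ↦ ?_
    rw [← Polynomial.coeff_map, Polynomial.map_prod]
    congr 1
    refine Fintype.prod_equiv (e g) _ _ fun g' ↦ ?_
    simp [he]
  have h1 : (P.map ψ).eval (ψ d) = 0 := by
    rw [Polynomial.map_prod, Polynomial.eval_prod]
    refine Finset.prod_eq_zero (Finset.mem_univ g₁) ?_
    simp [hg₁]
  rw [← hP, Polynomial.map_prod, Polynomial.eval_prod, Finset.prod_eq_zero_iff] at h1
  obtain ⟨g, -, hg⟩ := h1
  refine hd' g ?_
  simpa [sub_eq_zero] using hg

/-- Every `d` is a root of the monic polynomial `∏ (X - τ g d)`, whose coefficients are invariant.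
-/
theorem isIntegral_subtype_of_forall_mem_iff (τ : G → D →+* D)
    (e : G → Equiv.Perm G) (he : ∀ g h x, τ g (τ h x) = τ (e g h) x) (g₁ : G)
    (hg₁ : ∀ x, τ g₁ x = x) (C : Subring D) (hC : ∀ x, x ∈ C ↔ ∀ g, τ g x = x) :
    C.subtype.IsIntegral := by
  intro d
  have := Fintype.ofFinite G
  let P : Polynomial D := ∏ g, (Polynomial.X - Polynomial.C (τ g d))
  have hP : P ∈ Polynomial.lifts C.subtype := by
    refine (Polynomial.lifts_iff_coeff_lifts _).2 fun i ↦ ⟨⟨P.coeff i, (hC _).2 fun g ↦ ?_⟩, rfl⟩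
    rw [← Polynomial.coeff_map, Polynomial.map_prod]
    congr 1
    refine Fintype.prod_equiv (e g) _ _ fun g' ↦ ?_
    simp [he]
  obtain ⟨p, hp1, -, hp2⟩ := Polynomial.lifts_and_natDegree_eq_and_monic hP
    (Polynomial.monic_prod_of_monic _ _ fun _ _ ↦ Polynomial.monic_X_sub_C _)
  refine ⟨p, hp2, ?_⟩
  rw [← Polynomial.eval_map, hp1, Polynomial.eval_prod]
  refine Finset.prod_eq_zero (Finset.mem_univ g₁) ?_
  simp [hg₁]

end Rings

/-! ### Tensor products of rings of invariants. -/

section TensorInvariants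
open scoped TensorProduct

variable {A : Type*} [CommRing A] {J : Type*} [Fintype J] [DecidableEq J]

section
variable {D : J → Type*} {P : Type*} [∀ j, CommRing (D j)] [∀ j, Algebra A (D j)] [CommRing P]
  [Algebra A P]

/-- The homomorphism `⨂ d_j ↦ ∏ q_j(d_j)` from a tensor product of algebras. -/
noncomputable def tensorLift (q : ∀ j, D j →ₐ[A] P) : (⨂[A] j, D j) →ₐ[A] P :=
  PiTensorProduct.liftAlgHom
    ((MultilinearMap.mkPiAlgebra A J P).compLinearMap fun j ↦ (q j).toLinearMap)
    (by simp) (fun x y ↦ by simp [Finset.prod_mul_distrib])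

theorem tensorLift_tprod (q : ∀ j, D j →ₐ[A] P) (x : ∀ j, D j) :
    tensorLift q (PiTensorProduct.tprod A x) = ∏ j, q j (x j) := by
  refine (PiTensorProduct.lift.tprod x).trans ?_
  simp

theorem tensorLift_single (q : ∀ j, D j →ₐ[A] P) (j : J) (x : D j) :
    tensorLift q (PiTensorProduct.singleAlgHom j x) = q j x := by
  rw [PiTensorProduct.singleAlgHom_apply, tensorLift_tprod, Finset.prod_eq_single j]
  · simp
  · intro i _ hi
    simp [hi]
  · simp

/-- Together with `tensorLift_comp` this identifies a coproduct `P`, known only by its universal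
property, with the concrete tensor product. -/
theorem comp_tensorLift (q : ∀ j, D j →ₐ[A] P) (ρ : P →ₐ[A] ⨂[A] j, D j)
    (hρ : ∀ j x, ρ (q j x) = PiTensorProduct.singleAlgHom j x) (x : ⨂[A] j, D j) :
    ρ (tensorLift q x) = x := by
  suffices h : ρ.comp (tensorLift q) = AlgHom.id A _ from DFunLike.congr_fun h x
  refine PiTensorProduct.algHom_ext fun j ↦ AlgHom.ext fun y ↦ ?_
  rw [AlgHom.comp_apply, AlgHom.comp_apply, tensorLift_single, hρ]
  rfl

theorem tensorLift_comp (q : ∀ j, D j →ₐ[A] P) (ρ : P →ₐ[A] ⨂[A] j, D j)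
    (hρ : ∀ j x, ρ (q j x) = PiTensorProduct.singleAlgHom j x)
    (hP : ∀ φ ψ : P →ₐ[A] P, (∀ j, φ.comp (q j) = ψ.comp (q j)) → φ = ψ) (y : P) :
    tensorLift q (ρ y) = y := by
  suffices h : (tensorLift q).comp ρ = AlgHom.id A _ from DFunLike.congr_fun h y
  refine hP _ _ fun j ↦ AlgHom.ext fun x ↦ ?_
  rw [AlgHom.comp_apply, AlgHom.comp_apply, hρ, tensorLift_single]
  rfl
end

/-- The averaging operator onto the invariants of a finite group. -/
theorem exists_reynolds {D C G : Type*} [CommRing D] [CommRing C] [Algebra A D] [Algebra A C]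
    [Fintype G] (i : C →ₐ[A] D) (hi : Function.Injective i) (τ : G → D →ₐ[A] D)
    (e : G → Equiv.Perm G) (he : ∀ g h x, τ g (τ h x) = τ (e g h) x)
    (hC : ∀ x, x ∈ i.range ↔ ∀ g, τ g x = x) (u : A) (hu : u * Fintype.card G = 1) :
    ∃ r : D →ₗ[A] C, (∀ d, i (r d) = u • ∑ g, τ g d) ∧ ∀ c, r (i c) = c := by
  have hmem : ∀ d, u • ∑ g, τ g d ∈ i.range := fun d ↦ (hC _).2 fun g ↦ by
    rw [map_smul, map_sum]
    congr 1
    exact Fintype.sum_equiv (e g) _ _ fun h ↦ he g h d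
  choose r hr using fun d ↦ AlgHom.mem_range i |>.1 (hmem d)
  refine ⟨{ toFun := r, map_add' := fun x y ↦ hi ?_, map_smul' := fun a x ↦ hi ?_ }, hr,
    fun c ↦ hi ((hr _).trans ?_)⟩
  · simp [hr, Finset.sum_add_distrib]
  · simp only [RingHom.id_apply, map_smul, hr, ← Finset.smul_sum, smul_comm u a]
  · have h : ∀ g, τ g (i c) = i c := (hC _).1 ⟨c, rfl⟩
    simp only [h, Finset.sum_const, Finset.card_univ, ← Nat.cast_smul_eq_nsmul A, smul_smul, hu,
      one_smul]

variable {D C : J → Type*} [∀ j, CommRing (D j)] [∀ j, Algebra A (D j)]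
  [∀ j, CommRing (C j)] [∀ j, Algebra A (C j)] {P Q : Type*} [CommRing P] [Algebra A P]
  [CommRing Q] [Algebra A Q]

/-- A coproduct of algebras of invariants of finite groups of invertible order is the algebra of
invariants of the product group in the coproduct. -/
theorem injective_and_mem_range_of_invariants {G : J → Type*} [∀ j, Fintype (G j)]
    (i : ∀ j, C j →ₐ[A] D j) (hi : ∀ j, Function.Injective (i j))
    (τ : ∀ j, G j → D j →ₐ[A] D j) (e : ∀ j, G j → Equiv.Perm (G j))
    (he : ∀ j g h x, τ j g (τ j h x) = τ j (e j g h) x)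
    (hC : ∀ j x, x ∈ (i j).range ↔ ∀ g, τ j g x = x)
    (u : J → A) (hu : ∀ j, u j * Fintype.card (G j) = 1)
    (q : ∀ j, D j →ₐ[A] P) (ρP : P →ₐ[A] ⨂[A] j, D j)
    (hρP : ∀ j x, ρP (q j x) = PiTensorProduct.singleAlgHom j x)
    (hP : ∀ φ ψ : P →ₐ[A] P, (∀ j, φ.comp (q j) = ψ.comp (q j)) → φ = ψ)
    (c : ∀ j, C j →ₐ[A] Q) (ρQ : Q →ₐ[A] ⨂[A] j, C j)
    (hρQ : ∀ j x, ρQ (c j x) = PiTensorProduct.singleAlgHom j x)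
    (hQ : ∀ φ ψ : Q →ₐ[A] Q, (∀ j, φ.comp (c j) = ψ.comp (c j)) → φ = ψ)
    (ι : Q →ₐ[A] P) (hι : ∀ j x, ι (c j x) = q j (i j x))
    (a : (∀ j, G j) → P →ₐ[A] P) (ha : ∀ g j x, a g (q j x) = q j (τ j (g j) x)) :
    Function.Injective ι ∧ ∀ y, (∀ g, a g y = y) → y ∈ Set.range ι := by
  choose r hr hri using fun j ↦ exists_reynolds (i j) (hi j) (τ j) (e j) (he j) (hC j) (u j) (hu j)
  -- The tensor product of the averaging operators, transported to `P` and `Q`. It is linear only,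
  -- but it is a retraction of `ι`, which gives injectivity.
  let R : P →ₗ[A] Q := (tensorLift c).toLinearMap ∘ₗ PiTensorProduct.map r ∘ₗ ρP.toLinearMap
  have hR : ∀ x, R (tensorLift q x) = tensorLift c (PiTensorProduct.map r x) := fun x ↦ by
    change tensorLift c (PiTensorProduct.map r (ρP (tensorLift q x))) = _
    rw [comp_tensorLift q ρP hρP]
  have h1 : ∀ x, R (ι (tensorLift c x)) = tensorLift c x := fun x ↦ by
    suffices h : R ∘ₗ ι.toLinearMap ∘ₗ (tensorLift c).toLinearMap = (tensorLift c).toLinearMap from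
      DFunLike.congr_fun h x
    refine PiTensorProduct.ext (MultilinearMap.ext fun x ↦ ?_)
    change R (ι (tensorLift c (PiTensorProduct.tprod A x))) =
      tensorLift c (PiTensorProduct.tprod A x)
    have : ι (tensorLift c (PiTensorProduct.tprod A x)) =
        tensorLift q (PiTensorProduct.tprod A fun j ↦ i j (x j)) := by
      simp [tensorLift_tprod, hι]
    rw [this, hR, PiTensorProduct.map_tprod]
    simp only [hri]
  refine ⟨Function.LeftInverse.injective (g := R) fun y ↦ ?_, fun y hy ↦ ⟨R y, ?_⟩⟩
  · obtain ⟨x, rfl⟩ : ∃ x, tensorLift c x = y := ⟨_, tensorLift_comp c ρQ hρQ hQ y⟩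
    exact h1 x
  -- Expanding `∏ j, ∑ g_j` into a sum over the product group shows that `ι ∘ R` is the average over
  -- that group; it therefore fixes invariant elements.
  have h2 : ∀ x, ι (tensorLift c (PiTensorProduct.map r x)) =
      (∏ j, u j) • ∑ g, a g (tensorLift q x) := fun x ↦ by
    suffices h : ι.toLinearMap ∘ₗ (tensorLift c).toLinearMap ∘ₗ PiTensorProduct.map r =
        (∏ j, u j) • ∑ g, (a g).toLinearMap ∘ₗ (tensorLift q).toLinearMap by
      simpa using DFunLike.congr_fun h x
    refine PiTensorProduct.ext (MultilinearMap.ext fun x ↦ ?_)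
    have : ι (tensorLift c (PiTensorProduct.map r (PiTensorProduct.tprod A x))) =
        (∏ j, u j) • ∑ g, a g (tensorLift q (PiTensorProduct.tprod A x)) := by
      simp only [PiTensorProduct.map_tprod, tensorLift_tprod, map_prod, hι, hr, ha, map_smul,
        map_sum, Finset.prod_smul, Finset.prod_univ_sum, Fintype.piFinset_univ]
    simpa using this
  obtain ⟨x, rfl⟩ : ∃ x, tensorLift q x = y := ⟨_, tensorLift_comp q ρP hρP hP y⟩
  rw [hR, h2]
  simp only [hy, Finset.sum_const, Finset.card_univ, ← Nat.cast_smul_eq_nsmul A, smul_smul]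
  simp only [Fintype.card_pi, Nat.cast_prod, ← Finset.prod_mul_distrib, hu, Finset.prod_const_one,
    one_smul]

end TensorInvariants

/-! ### Morphisms over `X`, seen through functions over affine opens of `X`. -/

section OverApp
variable {X Y Z W : Scheme.{u}} (g : Y ⟶ Z) (h : Z ⟶ W) {b : Y ⟶ X} {p : Z ⟶ X} {q : W ⟶ X}

theorem preimage_le_preimage_preimage (hg : g ≫ p = b) (U : X.Opens) :
    b ⁻¹ᵁ U ≤ g ⁻¹ᵁ p ⁻¹ᵁ U := by
  rw [← Scheme.Hom.comp_preimage, hg]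

/-- The map on functions over an open set `U` of `X` induced by a morphism over `X`. -/
noncomputable def overApp (hg : g ≫ p = b) (U : X.Opens) : Γ(Z, p ⁻¹ᵁ U) ⟶ Γ(Y, b ⁻¹ᵁ U) :=
  g.appLE (p ⁻¹ᵁ U) (b ⁻¹ᵁ U) (preimage_le_preimage_preimage g hg U)

theorem app_overApp (hg : g ≫ p = b) (U : X.Opens) : p.app U ≫ overApp g hg U = b.app U := by
  subst hg
  rw [overApp, Scheme.Hom.app_eq_appLE, Scheme.Hom.appLE_comp_appLE, Scheme.Hom.app_eq_appLE]

theorem overApp_comp (hg : g ≫ p = b) (hh : h ≫ q = p) (hgh : (g ≫ h) ≫ q = b) (U : X.Opens) :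
    overApp h hh U ≫ overApp g hg U = overApp (g ≫ h) hgh U :=
  Scheme.Hom.appLE_comp_appLE ..

theorem overApp_id (U : X.Opens) : overApp (𝟙 Y) (Category.id_comp b) U = 𝟙 _ := by
  exact (Category.id_comp _).trans (Y.presheaf.map_id _)

theorem overApp_congr {g g' : Y ⟶ Z} (e : g = g') (hg : g ≫ p = b) (hg' : g' ≫ p = b)
    (U : X.Opens) : overApp g hg U = overApp g' hg' U := by
  subst e; rfl

theorem overApp_map (hg : g ≫ p = b) {U V : X.Opens} (i : U ≤ V) :
    overApp g hg V ≫ Y.presheaf.map (homOfLE (b.preimage_mono i)).op =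
      Z.presheaf.map (homOfLE (p.preimage_mono i)).op ≫ overApp g hg U := by
  rw [overApp, overApp, Scheme.Hom.appLE_map, Scheme.Hom.map_appLE]

theorem spec_map_overApp_fromSpec (hg : g ≫ p = b) {U : X.Opens} (h₁ : IsAffineOpen (p ⁻¹ᵁ U))
    (h₂ : IsAffineOpen (b ⁻¹ᵁ U)) :
    Spec.map (overApp g hg U) ≫ h₁.fromSpec = h₂.fromSpec ≫ g :=
  h₁.SpecMap_appLE_fromSpec g h₂ _

theorem spec_map_app_fromSpec (p : Z ⟶ X) {U : X.Opens} (hU : IsAffineOpen U)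
    (h₁ : IsAffineOpen (p ⁻¹ᵁ U)) : Spec.map (p.app U) ≫ hU.fromSpec = h₁.fromSpec ≫ p := by
  rw [Scheme.Hom.app_eq_appLE]
  exact hU.SpecMap_appLE_fromSpec p h₁ _
end OverApp

section AffinePieces
variable {X Y : Scheme.{u}} {T : CommRingCat.{u}}

theorem exists_spec_map_fromSpec {V : Y.Opens} (hV : IsAffineOpen V) (m : Spec T ⟶ Y)
    (h : Set.range m ⊆ V) : ∃ φ : Γ(Y, V) ⟶ T, Spec.map φ ≫ hV.fromSpec = m := by
  refine ⟨Spec.preimage (IsOpenImmersion.lift hV.fromSpec m (by rwa [hV.range_fromSpec])), ?_⟩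
  rw [Spec.map_preimage, IsOpenImmersion.lift_fac]

theorem spec_map_fromSpec_inj {V : Y.Opens} (hV : IsAffineOpen V) {φ ψ : Γ(Y, V) ⟶ T}
    (h : Spec.map φ ≫ hV.fromSpec = Spec.map ψ ≫ hV.fromSpec) : φ = ψ := by
  rwa [cancel_mono, Spec.map_inj] at h

variable (π : Y ⟶ X) [IsAffineHom π] {U : X.Opens} (hU : IsAffineOpen U)

theorem exists_spec_map_preimage_fromSpec (m : Spec T ⟶ Y) (h : Γ(X, U) ⟶ T)
    (hm : m ≫ π = Spec.map h ≫ hU.fromSpec) :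
    ∃ φ : Γ(Y, π ⁻¹ᵁ U) ⟶ T, Spec.map φ ≫ (hU.preimage π).fromSpec = m ∧ π.app U ≫ φ = h := by
  obtain ⟨φ, hφ⟩ := exists_spec_map_fromSpec (hU.preimage π) m (by
    rintro _ ⟨x, rfl⟩
    change (m ≫ π) x ∈ U
    rw [hm]
    exact hU.range_fromSpec.le ⟨_, rfl⟩)
  refine ⟨φ, hφ, spec_map_fromSpec_inj hU ?_⟩
  rw [Spec.map_comp, Category.assoc, spec_map_app_fromSpec π hU (hU.preimage π), reassoc_of% hφ, hm]
end AffinePieces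

section WidePullback
variable {I : Type} [Finite I] {X : Scheme.{u}} {Y : I → Scheme.{u}} (p : ∀ i, Y i ⟶ X)
  [∀ i, IsAffineHom (p i)] {U : X.Opens} {T : CommRingCat.{u}}

/-- With `widePullback_app_ext`, this says that the functions on a fibre product over an affine open
are the coproduct of the algebras of the factors: it is the universal property of the fibre product,
tested on `Spec T`. -/
theorem exists_widePullback_app (hU : IsAffineOpen U) (h : Γ(X, U) ⟶ T) (φ : ∀ i, Γ(Y i, p i ⁻¹ᵁ U) ⟶ T)
    (w : ∀ i, (p i).app U ≫ φ i = h) :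
    ∃ H : Γ(widePullback X Y p, WidePullback.base p ⁻¹ᵁ U) ⟶ T,
      (WidePullback.base p).app U ≫ H = h ∧
      ∀ i, overApp (WidePullback.π p i) (WidePullback.π_arrow p i) U ≫ H = φ i := by
  let m : Spec T ⟶ widePullback X Y p := WidePullback.lift (Spec.map h ≫ hU.fromSpec)
    (fun i ↦ Spec.map (φ i) ≫ (hU.preimage (p i)).fromSpec) fun i ↦ by
      rw [Category.assoc, ← spec_map_app_fromSpec (p i) hU, ← Spec.map_comp_assoc, w]
  obtain ⟨H, hH, hH'⟩ := exists_spec_map_preimage_fromSpec (WidePullback.base p) hU m h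
    (WidePullback.lift_base _ _ _ _)
  refine ⟨H, hH', fun i ↦ spec_map_fromSpec_inj (hU.preimage (p i)) ?_⟩
  rw [Spec.map_comp, Category.assoc, spec_map_overApp_fromSpec _ _ _ (hU.preimage _),
    reassoc_of% hH]
  exact WidePullback.lift_π _ _ _ _ _

theorem widePullback_app_ext (hU : IsAffineOpen U)
    (H H' : Γ(widePullback X Y p, WidePullback.base p ⁻¹ᵁ U) ⟶ T)
    (h : (WidePullback.base p).app U ≫ H = (WidePullback.base p).app U ≫ H')
    (hi : ∀ i, overApp (WidePullback.π p i) (WidePullback.π_arrow p i) U ≫ H =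
      overApp (WidePullback.π p i) (WidePullback.π_arrow p i) U ≫ H') : H = H' := by
  refine spec_map_fromSpec_inj (hU.preimage _) (WidePullback.hom_ext _ _ _ (fun i ↦ ?_) ?_)
  · rw [Category.assoc, Category.assoc, ← spec_map_overApp_fromSpec _ (WidePullback.π_arrow p i)
      (hU.preimage (p i)), ← Spec.map_comp_assoc, ← Spec.map_comp_assoc, hi]
  · rw [Category.assoc, Category.assoc, ← spec_map_app_fromSpec _ hU, ← Spec.map_comp_assoc,
      ← Spec.map_comp_assoc, h]
end WidePullback

/-! ### Relative spectra and finite quotients over an affine open. -/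

section RelSpecPieces
open Scheme AffineZariskiSite
variable {X : Scheme.{u}} {F : X.AffineZariskiSiteᵒᵖ ⥤ CommRingCat.{u}}
  {α : (toOpensFunctor X).op ⋙ X.presheaf ⟶ F} (H : α.Coequifibered)

/-- The glued-in piece and the preimage of `U` are affine open immersions with the same range. -/
theorem RelSpec.exists_iso (U : X.AffineZariskiSite) :
    ∃ ψ : Γ(RelSpec H, RelSpec.toBase H ⁻¹ᵁ U.1) ≅ F.obj (.op U),
      Spec.map ψ.hom ≫ (U.2.preimage (RelSpec.toBase H)).fromSpec = RelSpec.ι H U ∧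
      (RelSpec.toBase H).app U.1 ≫ ψ.hom = α.app (.op U) := by
  obtain ⟨φ, h1, h2⟩ := exists_spec_map_preimage_fromSpec (RelSpec.toBase H) U.2 (RelSpec.ι H U)
    (α.app (.op U)) (RelSpec.ι_toBase H U)
  have hr : Set.range (RelSpec.ι H U) = Set.range (U.2.preimage (RelSpec.toBase H)).fromSpec := by
    rw [IsAffineOpen.range_fromSpec, RelSpec.toBase_preimage]
    rfl
  have h3 : Spec.map φ = (IsOpenImmersion.isoOfRangeEq _ _ hr).hom := by
    rw [← cancel_mono (U.2.preimage (RelSpec.toBase H)).fromSpec, h1,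
      IsOpenImmersion.isoOfRangeEq_hom_fac]
  have : IsIso (Spec.map φ) := h3 ▸ inferInstance
  have : IsIso φ := (ConcreteCategory.isIso_iff_bijective φ).2 (isIso_SpecMap_iff.1 this)
  exact ⟨asIso φ, h1, h2⟩

theorem comp_eq_comp_of_spec {A B C D : CommRingCat.{u}} {W : Scheme.{u}} {a : A ⟶ B} {b : B ⟶ D}
    {c : A ⟶ C} {d : C ⟶ D} {j : Spec A ⟶ W} [Mono j] {jB : Spec B ⟶ W} {jC : Spec C ⟶ W}
    (h₁ : Spec.map a ≫ j = jB) (h₂ : Spec.map c ≫ j = jC)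
    (h₃ : Spec.map b ≫ jB = Spec.map d ≫ jC) : a ≫ b = c ≫ d := by
  rw [← Spec.map_inj, ← cancel_mono j, Spec.map_comp, Spec.map_comp, Category.assoc,
    Category.assoc, h₁, h₂, h₃]

theorem comp_inv_comp_eq {C : Type*} [Category C] {A B A' B' S T : C} (a : A ⟶ B) (b : A' ⟶ B')
    (ψ : A ≅ A') (ψ' : B ≅ B') (s : A ⟶ S) (t : B ⟶ T) (c : S ⟶ T) (h : a ≫ ψ'.hom = ψ.hom ≫ b)
    (h' : a ≫ t = s ≫ c) : b ≫ ψ'.inv ≫ t = (ψ.inv ≫ s) ≫ c := by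
  rw [Category.assoc, ← h', Iso.eq_inv_comp, ← reassoc_of% h, Iso.hom_inv_id_assoc]

theorem RelSpec.fromSpec_lift {Y : Scheme.{u}} (π : Y ⟶ X)
    (θ : ∀ U : X.AffineZariskiSite, F.obj (.op U) ⟶ Γ(Y, π ⁻¹ᵁ U.1))
    (hθ : ∀ {U V : X.AffineZariskiSite} (i : U ⟶ V), F.map i.op ≫ θ U =
      θ V ≫ Y.presheaf.map (homOfLE (π.preimage_mono (toOpens_mono i.le))).op)
    (U : X.AffineZariskiSite) (hU : IsAffineOpen (π ⁻¹ᵁ U.1)) :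
    hU.fromSpec ≫ RelSpec.lift H π θ @hθ = Spec.map (θ U) ≫ RelSpec.ι H U := by
  rw [IsAffineOpen.fromSpec, Category.assoc, RelSpec.ι_lift H π θ hθ U, RelSpec.liftPiece,
    ← IsAffineOpen.isoSpec_hom hU, Iso.inv_hom_id_assoc]
end RelSpecPieces

section QuotientPieces
open Scheme AffineZariskiSite
variable {X Y : Scheme.{u}} (π : Y ⟶ X) {G : Type*} (σ : G → (Y ⟶ Y)) (hσ : ∀ g, σ g ≫ π = π)
  [Finite G] [IsAffineHom π]

omit [Finite G] [IsAffineHom π] in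
theorem mem_invariants_iff_overApp {U : X.Opens} {s : Γ(Y, π ⁻¹ᵁ U)} :
    s ∈ invariants π σ hσ U ↔ ∀ g, overApp (σ g) (hσ g) U s = s :=
  mem_invariants π σ hσ

instance FiniteQuotient.isAffineHom_toBase : IsAffineHom (FiniteQuotient.toBase π σ hσ) :=
  RelSpec.isAffineHom_toBase _

/-- This replaces the gluing construction by its algebraic content: pullback along the quotient
morphism is the inclusion of the invariants. -/
theorem FiniteQuotient.exists_iso {U : X.Opens} (hU : IsAffineOpen U) :
    ∃ ψ : Γ(FiniteQuotient π σ hσ, FiniteQuotient.toBase π σ hσ ⁻¹ᵁ U) ≅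
        .of (invariants π σ hσ U),
      overApp (FiniteQuotient.mk π σ hσ) (FiniteQuotient.mk_toBase π σ hσ) U =
        ψ.hom ≫ CommRingCat.ofHom (invariants π σ hσ U).subtype := by
  obtain ⟨ψ, h1, -⟩ := RelSpec.exists_iso (coequifibered_invariantsDiagramMap π σ hσ) ⟨U, hU⟩
  refine ⟨ψ, spec_map_fromSpec_inj (hU.preimage (FiniteQuotient.toBase π σ hσ)) ?_⟩
  rw [spec_map_overApp_fromSpec _ _ _ (hU.preimage π), Spec.map_comp, Category.assoc]
  refine (RelSpec.fromSpec_lift (coequifibered_invariantsDiagramMap π σ hσ) π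
    (fun U ↦ CommRingCat.ofHom (invariants π σ hσ U.1).subtype) _ ⟨U, hU⟩ (hU.preimage π)).trans ?_
  exact congrArg _ h1.symm

theorem FiniteQuotient.overApp_mk_injective {U : X.Opens} (hU : IsAffineOpen U) :
    Function.Injective
      (overApp (FiniteQuotient.mk π σ hσ) (FiniteQuotient.mk_toBase π σ hσ) U) := by
  obtain ⟨ψ, h⟩ := FiniteQuotient.exists_iso π σ hσ hU
  rw [h]
  exact Subtype.val_injective.comp (ConcreteCategory.bijective_of_isIso ψ.hom).1

theorem FiniteQuotient.mem_range_overApp_mk {U : X.Opens} (hU : IsAffineOpen U)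
    (s : Γ(Y, π ⁻¹ᵁ U)) :
    s ∈ Set.range (overApp (FiniteQuotient.mk π σ hσ) (FiniteQuotient.mk_toBase π σ hσ) U) ↔
      ∀ g, overApp (σ g) (hσ g) U s = s := by
  obtain ⟨ψ, h⟩ := FiniteQuotient.exists_iso π σ hσ hU
  rw [h, ← mem_invariants_iff_overApp]
  constructor
  · rintro ⟨x, rfl⟩
    exact (ψ.hom x).2
  · intro hs
    obtain ⟨x, hx⟩ := (ConcreteCategory.bijective_of_isIso ψ.hom).2 ⟨s, hs⟩
    exact ⟨x, congr_arg Subtype.val hx⟩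

/-- A family of functions on the affine opens of `X` glues to a morphism to the quotient. -/
theorem FiniteQuotient.exists_lift {Z : Scheme.{u}} (p : Z ⟶ X)
    (θ : ∀ U : X.Opens, IsAffineOpen U →
      (Γ(FiniteQuotient π σ hσ, FiniteQuotient.toBase π σ hσ ⁻¹ᵁ U) ⟶ Γ(Z, p ⁻¹ᵁ U)))
    (hθ : ∀ (U V : X.Opens) (hU : IsAffineOpen U) (hV : IsAffineOpen V) (i : U ≤ V),
      (FiniteQuotient π σ hσ).presheaf.map (homOfLE
        ((FiniteQuotient.toBase π σ hσ).preimage_mono i)).op ≫ θ U hU =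
      θ V hV ≫ Z.presheaf.map (homOfLE (p.preimage_mono i)).op)
    (hα : ∀ U hU, (FiniteQuotient.toBase π σ hσ).app U ≫ θ U hU = p.app U) :
    ∃ (m : Z ⟶ FiniteQuotient π σ hσ) (hm : m ≫ FiniteQuotient.toBase π σ hσ = p),
      ∀ U hU, IsAffineOpen (p ⁻¹ᵁ U) → overApp m hm U = θ U hU := by
  choose ψ h1 h2 using RelSpec.exists_iso (coequifibered_invariantsDiagramMap π σ hσ)
  have hψ : ∀ {U V : X.AffineZariskiSite} (i : U ⟶ V),
      (FiniteQuotient π σ hσ).presheaf.map (homOfLE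
        ((FiniteQuotient.toBase π σ hσ).preimage_mono (toOpens_mono i.le))).op ≫ (ψ U).hom =
      (ψ V).hom ≫ (invariantsDiagram π σ hσ).map i.op := by
    intro U V i
    exact comp_eq_comp_of_spec (j := (V.2.preimage (FiniteQuotient.toBase π σ hσ)).fromSpec)
      (IsAffineOpen.map_fromSpec _ (U.2.preimage (FiniteQuotient.toBase π σ hσ)) _) (h1 V)
      ((h1 U).trans (RelSpec.map_ι _ i).symm)
  refine ⟨RelSpec.lift (coequifibered_invariantsDiagramMap π σ hσ) p
    (fun U ↦ (ψ U).inv ≫ θ U.1 U.2) (fun {U V} i ↦ ?_),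
    RelSpec.lift_toBase _ _ _ _ fun U ↦ ?_, fun U hU hpU ↦ ?_⟩
  · exact comp_inv_comp_eq _ _ (ψ V) (ψ U) (θ V.1 V.2) (θ U.1 U.2) _ (hψ i)
      (hθ U.1 V.1 U.2 V.2 (toOpens_mono i.le))
  · refine (congrArg (· ≫ _) (h2 U).symm).trans ((Category.assoc _ _ _).trans ?_)
    exact (congrArg _ (Iso.hom_inv_id_assoc _ _)).trans (hα U.1 U.2)
  · refine spec_map_fromSpec_inj (hU.preimage (FiniteQuotient.toBase π σ hσ)) ?_
    refine (spec_map_overApp_fromSpec _ _ (hU.preimage (FiniteQuotient.toBase π σ hσ)) hpU).trans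
      ((RelSpec.fromSpec_lift _ _ _ _ ⟨U, hU⟩ hpU).trans ?_)
    refine (congrArg _ (h1 ⟨U, hU⟩).symm).trans ?_
    refine (Spec.map_comp_assoc _ _ _).symm.trans ?_
    exact congrArg (Spec.map · ≫ _) (Iso.hom_inv_id_assoc _ _)

end QuotientPieces

/-! ### Invariants in coproducts given by a universal property. -/

section CoproductInvariants
open scoped TensorProduct

/-- A form of `injective_and_mem_range_of_invariants` for coproducts given by their universal
property. -/
theorem injective_and_mem_range_of_coproduct {A : CommRingCat.{u}} {J : Type} [Fintype J]
    [DecidableEq J] {D C : J → CommRingCat.{u}} {P Q : CommRingCat.{u}} (d : ∀ j, A ⟶ D j)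
    (c : ∀ j, A ⟶ C j) (p : A ⟶ P) (q : A ⟶ Q) (i : ∀ j, C j ⟶ D j) (hci : ∀ j, c j ≫ i j = d j)
    (hi : ∀ j, Function.Injective (i j)) {G : J → Type*} [∀ j, Fintype (G j)]
    (τ : ∀ j, G j → (D j ⟶ D j)) (hτ : ∀ j g, d j ≫ τ j g = d j)
    (e : ∀ j, G j → Equiv.Perm (G j)) (he : ∀ j g h, τ j h ≫ τ j g = τ j (e j g h))
    (hC : ∀ j x, x ∈ Set.range (i j) ↔ ∀ g, τ j g x = x)
    (u : J → A) (hu : ∀ j, u j * Fintype.card (G j) = 1)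
    (κ : ∀ j, D j ⟶ P) (hκ : ∀ j, d j ≫ κ j = p)
    (hP : ∀ (T : CommRingCat.{u}) (h : A ⟶ T) (φ : ∀ j, D j ⟶ T), (∀ j, d j ≫ φ j = h) →
      ∃ H : P ⟶ T, p ≫ H = h ∧ ∀ j, κ j ≫ H = φ j)
    (hP' : ∀ (T : CommRingCat.{u}) (H H' : P ⟶ T), p ≫ H = p ≫ H' →
      (∀ j, κ j ≫ H = κ j ≫ H') → H = H')
    (ν : ∀ j, C j ⟶ Q) (hν : ∀ j, c j ≫ ν j = q)
    (hQ : ∀ (T : CommRingCat.{u}) (h : A ⟶ T) (φ : ∀ j, C j ⟶ T), (∀ j, c j ≫ φ j = h) →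
      ∃ H : Q ⟶ T, q ≫ H = h ∧ ∀ j, ν j ≫ H = φ j)
    (hQ' : ∀ (T : CommRingCat.{u}) (H H' : Q ⟶ T), q ≫ H = q ≫ H' →
      (∀ j, ν j ≫ H = ν j ≫ H') → H = H')
    (ι : Q ⟶ P) (hqι : q ≫ ι = p) (hι : ∀ j, ν j ≫ ι = i j ≫ κ j) :
    Function.Injective ι ∧ ∀ y, (∀ (g : ∀ j, G j) (a : P ⟶ P), p ≫ a = p →
      (∀ j, κ j ≫ a = τ j (g j) ≫ κ j) → a y = y) → y ∈ Set.range ι := by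
  let (j : J) : Algebra A (D j) := (d j).hom.toAlgebra
  let (j : J) : Algebra A (C j) := (c j).hom.toAlgebra
  let : Algebra A P := p.hom.toAlgebra
  let : Algebra A Q := q.hom.toAlgebra
  let i' (j : J) : C j →ₐ[A] D j := { (i j).hom with commutes' := fun a ↦ congr($(hci j) a) }
  let τ' (j : J) (g : G j) : D j →ₐ[A] D j :=
    { (τ j g).hom with commutes' := fun a ↦ congr($(hτ j g) a) }
  let κ' (j : J) : D j →ₐ[A] P := { (κ j).hom with commutes' := fun a ↦ congr($(hκ j) a) }
  let ν' (j : J) : C j →ₐ[A] Q := { (ν j).hom with commutes' := fun a ↦ congr($(hν j) a) }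
  let ι' : Q →ₐ[A] P := { ι.hom with commutes' := fun a ↦ congr($hqι a) }
  obtain ⟨ρP, hρP, hρP'⟩ := hP (.of (⨂[A] j, D j)) (CommRingCat.ofHom (algebraMap A _))
    (fun j ↦ CommRingCat.ofHom
      (PiTensorProduct.singleAlgHom (R := A) (A := fun j ↦ D j) j).toRingHom) fun j ↦ by
      ext a; exact (PiTensorProduct.singleAlgHom (R := A) (A := fun j ↦ D j) j).commutes a
  obtain ⟨ρQ, hρQ, hρQ'⟩ := hQ (.of (⨂[A] j, C j)) (CommRingCat.ofHom (algebraMap A _))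
    (fun j ↦ CommRingCat.ofHom
      (PiTensorProduct.singleAlgHom (R := A) (A := fun j ↦ C j) j).toRingHom) fun j ↦ by
      ext a; exact (PiTensorProduct.singleAlgHom (R := A) (A := fun j ↦ C j) j).commutes a
  -- The product group acts on `P` factor by factor, by the universal property.
  have ha (g : ∀ j, G j) := hP P p (fun j ↦ τ j (g j) ≫ κ j) fun j ↦ by
    rw [reassoc_of% hτ j, hκ]
  choose a ha ha' using ha
  have key := injective_and_mem_range_of_invariants (A := A) i' hi τ' e
    (fun j g h x ↦ congr($(he j g h) x)) hC u hu κ'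
    { ρP.hom with commutes' := fun a ↦ congr($hρP a) } (fun j x ↦ congr($(hρP' j) x))
    (fun φ ψ h ↦ by
      have := hP' P (CommRingCat.ofHom φ.toRingHom) (CommRingCat.ofHom ψ.toRingHom)
        (by ext a; exact (φ.commutes a).trans (ψ.commutes a).symm)
        (fun j ↦ by ext x; exact congr($(h j) x))
      ext x; exact congr($this x)) ν'
    { ρQ.hom with commutes' := fun a ↦ congr($hρQ a) } (fun j x ↦ congr($(hρQ' j) x))
    (fun φ ψ h ↦ by
      have := hQ' Q (CommRingCat.ofHom φ.toRingHom) (CommRingCat.ofHom ψ.toRingHom)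
        (by ext a; exact (φ.commutes a).trans (ψ.commutes a).symm)
        (fun j ↦ by ext x; exact congr($(h j) x))
      ext x; exact congr($this x)) ι' (fun j x ↦ congr($(hι j) x))
    (fun g ↦ { (a g).hom with commutes' := fun x ↦ congr($(ha g) x) })
    (fun g j x ↦ congr($(ha' g j) x))
  exact ⟨key.1, fun y hy ↦ key.2 y fun g ↦ hy g (a g) (ha g) (ha' g)⟩

theorem exists_comp_eq_of_range_subset {P Q R : CommRingCat.{u}} (ι : Q ⟶ P)
    (hι : Function.Injective ι) (β : R ⟶ P) (h : ∀ x, β x ∈ Set.range ι) :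
    ∃ θ : R ⟶ Q, θ ≫ ι = β := by
  choose θ hθ using h
  refine ⟨CommRingCat.ofHom
    { toFun := θ
      map_one' := hι ?_
      map_mul' := fun x y ↦ hι ?_
      map_zero' := hι ?_
      map_add' := fun x y ↦ hι ?_ }, by ext x; exact hθ x⟩ <;> simp [hθ]

theorem comp_injective_cancel {P Q R : CommRingCat.{u}} {ι : Q ⟶ P} (hι : Function.Injective ι)
    {a b : R ⟶ Q} (h : a ≫ ι = b ≫ ι) : a = b := by
  ext x
  exact hι congr($h x)

end CoproductInvariants

section HomExt
variable {X Y Z : Scheme.{u}}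

theorem hom_ext_of_overApp {m m' : Y ⟶ Z} {b : Y ⟶ X} {p : Z ⟶ X} [IsAffineHom b] [IsAffineHom p]
    (hm : m ≫ p = b) (hm' : m' ≫ p = b)
    (h : ∀ U, IsAffineOpen U → overApp m hm U = overApp m' hm' U) : m = m' := by
  refine Scheme.Cover.hom_ext (Y.openCoverOfIsOpenCover _
    (.comap (iSup_affineOpens_eq_top X) b.base.1)) _ _ fun U ↦ ?_
  have h1 : (U.2.preimage b).fromSpec ≫ m = (U.2.preimage b).fromSpec ≫ m' := by
    rw [← spec_map_overApp_fromSpec m hm (U.2.preimage p) (U.2.preimage b), h U.1 U.2,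
      spec_map_overApp_fromSpec m' hm' (U.2.preimage p) (U.2.preimage b)]
  rw [IsAffineOpen.fromSpec, Category.assoc, Category.assoc, cancel_epi] at h1
  exact h1
end HomExt

/-- Bijections between corresponding fibres are assembled. This is why the weighted sum does not
depend on the map that distributes the repeated points. -/
theorem exists_equiv_comp_eq {ι ι' κ : Type*} [Finite ι] [Finite ι'] (r : ι → κ) (r' : ι' → κ)
    (h : ∀ x, (r ⁻¹' {x}).ncard = (r' ⁻¹' {x}).ncard) : ∃ σ : ι ≃ ι', r' ∘ σ = r := by
  have (x : κ) : Nonempty ({i // r i = x} ≃ {i // r' i = x}) :=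
    Finite.card_eq.1 (h x)
  let E (x : κ) := (this x).some
  refine ⟨(Equiv.sigmaFiberEquiv r).symm.trans
    ((Equiv.sigmaCongrRight E).trans (Equiv.sigmaFiberEquiv r')), funext fun i ↦ ?_⟩
  exact (E (r i) ⟨i, rfl⟩).2

/-! ### Fibre powers of the cotangent bundle. -/

section Power
variable {S X : Scheme.{u}} (f : X ⟶ S) [IsAffine S] [Smooth f]
namespace CotangentPower
variable {I J K : Type} [Finite I] [Finite J] [Finite K]

variable {f} in
theorem hom_ext {W : Scheme.{u}} {m m' : W ⟶ CotangentPower f I}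
    (h : m ≫ toBase f I = m' ≫ toBase f I) (hi : ∀ i, m ≫ proj f i = m' ≫ proj f i) : m = m' :=
  WidePullback.hom_ext _ _ _ hi h

theorem reindex_comp (s : J → K) (r : I → J) : reindex f s ≫ reindex f r = reindex f (s ∘ r) := by
  refine hom_ext ?_ fun i ↦ ?_
  · rw [Category.assoc, reindex_toBase, reindex_toBase, reindex_toBase]
  · rw [Category.assoc, reindex_proj, reindex_proj, reindex_proj]
    rfl

theorem reindex_id : reindex f (id : I → I) = 𝟙 _ := by
  refine hom_ext ?_ fun i ↦ ?_
  · rw [reindex_toBase, Category.id_comp]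
  · rw [reindex_proj, Category.id_comp]
    rfl

theorem proj_toBase (i : I) : proj f i ≫ CotangentBundle.toBase f = toBase f I :=
  WidePullback.π_arrow (fun _ : I ↦ CotangentBundle.toBase f) i

/-- The map on functions given by the reindexing morphism. -/
noncomputable def reindexApp (r : I → J) (U : X.Opens) :
    Γ(CotangentPower f I, toBase f I ⁻¹ᵁ U) ⟶ Γ(CotangentPower f J, toBase f J ⁻¹ᵁ U) :=
  overApp (reindex f r) (reindex_toBase f r) U

theorem app_reindexApp (r : I → J) (U : X.Opens) :
    (toBase f I).app U ≫ reindexApp f r U = (toBase f J).app U :=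
  app_overApp _ _ _

/-- Reindexing is contravariant on fibre powers and pullback reverses it again, so permutations act
on functions from the left. -/
theorem reindexApp_comp (s : J → K) (r : I → J) (U : X.Opens) :
    reindexApp f r U ≫ reindexApp f s U = reindexApp f (s ∘ r) U := by
  have h : (reindex f s ≫ reindex f r) ≫ toBase f I = toBase f K := by
    rw [Category.assoc, reindex_toBase, reindex_toBase]
  rw [reindexApp, reindexApp, overApp_comp _ _ _ _ h]
  exact overApp_congr (reindex_comp f s r) _ _ U

theorem reindexApp_id (U : X.Opens) : reindexApp f (id : I → I) U = 𝟙 _ :=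
  (overApp_congr (reindex_id f) _ _ U).trans (overApp_id U)

theorem projApp_reindexApp (r : I → J) (i : I) (U : X.Opens) :
    overApp (proj f i) (proj_toBase f i) U ≫ reindexApp f r U =
      overApp (proj f (r i)) (proj_toBase f (r i)) U := by
  have h : (reindex f r ≫ proj f i) ≫ CotangentBundle.toBase f = toBase f J := by
    rw [Category.assoc, proj_toBase, reindex_toBase]
  rw [reindexApp, overApp_comp _ _ _ _ h]
  exact overApp_congr (reindex_proj f r i) _ _ U

variable {T : CommRingCat.{u}} {U : X.Opens}

theorem app_ext (hU : IsAffineOpen U) (H H' : Γ(CotangentPower f I, toBase f I ⁻¹ᵁ U) ⟶ T)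
    (h : (toBase f I).app U ≫ H = (toBase f I).app U ≫ H')
    (hi : ∀ i, overApp (proj f i) (proj_toBase f i) U ≫ H =
      overApp (proj f i) (proj_toBase f i) U ≫ H') : H = H' :=
  widePullback_app_ext (fun _ : I ↦ CotangentBundle.toBase f) hU H H' h hi

theorem exists_app (hU : IsAffineOpen U) (h : Γ(X, U) ⟶ T)
    (φ : I → (Γ(CotangentBundle f, CotangentBundle.toBase f ⁻¹ᵁ U) ⟶ T))
    (w : ∀ i, (CotangentBundle.toBase f).app U ≫ φ i = h) :
    ∃ H : Γ(CotangentPower f I, toBase f I ⁻¹ᵁ U) ⟶ T, (toBase f I).app U ≫ H = h ∧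
      ∀ i, overApp (proj f i) (proj_toBase f i) U ≫ H = φ i :=
  exists_widePullback_app (fun _ : I ↦ CotangentBundle.toBase f) hU h φ w

variable {B : J → Type} [∀ j, Finite (B j)]

theorem app_sigma_ext (hU : IsAffineOpen U)
    (H H' : Γ(CotangentPower f (Σ j, B j), toBase f (Σ j, B j) ⁻¹ᵁ U) ⟶ T)
    (h : (toBase f (Σ j, B j)).app U ≫ H = (toBase f (Σ j, B j)).app U ≫ H')
    (hj : ∀ j, reindexApp f (Sigma.mk j : B j → Σ j, B j) U ≫ H =
      reindexApp f (Sigma.mk j) U ≫ H') : H = H' := by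
  refine app_ext f hU H H' h fun x ↦ ?_
  rw [← projApp_reindexApp f (Sigma.mk x.1 : B x.1 → Σ j, B j) x.2 U, Category.assoc,
    Category.assoc, hj]

/-- With `app_sigma_ext`: a fibre power over a disjoint union of index sets is the fibre product of
the powers, hence its functions form a coproduct. -/
theorem exists_app_sigma (hU : IsAffineOpen U) (h : Γ(X, U) ⟶ T)
    (φ : ∀ j, Γ(CotangentPower f (B j), toBase f (B j) ⁻¹ᵁ U) ⟶ T)
    (w : ∀ j, (toBase f (B j)).app U ≫ φ j = h) :
    ∃ H : Γ(CotangentPower f (Σ j, B j), toBase f (Σ j, B j) ⁻¹ᵁ U) ⟶ T,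
      (toBase f (Σ j, B j)).app U ≫ H = h ∧
      ∀ j, reindexApp f (Sigma.mk j : B j → Σ j, B j) U ≫ H = φ j := by
  obtain ⟨H, hH, hH'⟩ := exists_app f (I := Σ j, B j) hU h
    (fun x ↦ overApp (proj f x.2) (proj_toBase f x.2) U ≫ φ x.1) fun x ↦ by
      rw [← Category.assoc, app_overApp, w]
  refine ⟨H, hH, fun j ↦ app_ext f hU _ _ ?_ fun i ↦ ?_⟩
  · rw [← Category.assoc, app_reindexApp, hH, w]
  · rw [← Category.assoc, projApp_reindexApp, hH']

end CotangentPower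
end Power
-- Chow schemes and the morphism `τ`.
section Tau
variable {S X : Scheme.{u}} (f : X ⟶ S) [IsAffine S] [Smooth f]
namespace Chow
open CotangentPower

instance isAffineHom_toBase (n : ℕ) : IsAffineHom (toBase f n) :=
  FiniteQuotient.isAffineHom_toBase _ _ _

/-- The map on functions given by the quotient morphism to the Chow scheme. -/
noncomputable def mkApp (n : ℕ) (U : X.Opens) :
    Γ(Chow f n, toBase f n ⁻¹ᵁ U) ⟶
      Γ(CotangentPower f (Fin n), CotangentPower.toBase f (Fin n) ⁻¹ᵁ U) :=
  overApp (mk f n) (mk_toBase f n) U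

variable {U : X.Opens}

theorem mkApp_injective (n : ℕ) (hU : IsAffineOpen U) : Function.Injective (mkApp f n U) :=
  FiniteQuotient.overApp_mk_injective _ _ _ hU

theorem mem_range_mkApp (n : ℕ) (hU : IsAffineOpen U)
    (x : Γ(CotangentPower f (Fin n), CotangentPower.toBase f (Fin n) ⁻¹ᵁ U)) :
    x ∈ Set.range (mkApp f n U) ↔ ∀ g : Equiv.Perm (Fin n), reindexApp f g U x = x :=
  FiniteQuotient.mem_range_overApp_mk _ _ _ hU x

/-- A compatible family of maps on functions over the affine opens of `X` glues to a morphism to the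
Chow scheme. -/
theorem exists_lift {n : ℕ} {Z : Scheme.{u}} (p : Z ⟶ X)
    (θ : ∀ U : X.Opens, IsAffineOpen U → (Γ(Chow f n, toBase f n ⁻¹ᵁ U) ⟶ Γ(Z, p ⁻¹ᵁ U)))
    (hθ : ∀ (U V : X.Opens) (hU : IsAffineOpen U) (hV : IsAffineOpen V) (i : U ≤ V),
      (Chow f n).presheaf.map (homOfLE ((toBase f n).preimage_mono i)).op ≫ θ U hU =
      θ V hV ≫ Z.presheaf.map (homOfLE (p.preimage_mono i)).op)
    (hα : ∀ U hU, (toBase f n).app U ≫ θ U hU = p.app U) :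
    ∃ (m : Z ⟶ Chow f n) (hm : m ≫ toBase f n = p),
      ∀ U hU, IsAffineOpen (p ⁻¹ᵁ U) → overApp m hm U = θ U hU :=
  FiniteQuotient.exists_lift _ _ _ p θ hθ hα

theorem app_mkApp (n : ℕ) (U : X.Opens) :
    (toBase f n).app U ≫ mkApp f n U = (CotangentPower.toBase f (Fin n)).app U :=
  app_overApp _ _ _

theorem reindex_mk_toBase {J : Type} [Finite J] {n : ℕ} (r : Fin n → J) :
    (reindex f r ≫ mk f n) ≫ toBase f n = CotangentPower.toBase f J := by
  rw [Category.assoc, mk_toBase, reindex_toBase]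

theorem mkApp_reindexApp {J : Type} [Finite J] {n : ℕ} (r : Fin n → J) (U : X.Opens) :
    mkApp f n U ≫ reindexApp f r U = overApp (reindex f r ≫ mk f n) (reindex_mk_toBase f r) U :=
  overApp_comp _ _ _ _ _ _

theorem reindex_mk {n : ℕ} (g : Equiv.Perm (Fin n)) : reindex f g ≫ mk f n = mk f n := by
  refine hom_ext_of_overApp (reindex_mk_toBase f g) (mk_toBase f n) fun U hU ↦ ?_
  rw [← mkApp_reindexApp]
  ext x
  exact (mem_range_mkApp f n hU _).1 ⟨x, rfl⟩ g

variable {s : ℕ} (α : Fin s → ℕ)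

/-- The projection of the fibre product of Chow schemes to `X`. -/
noncomputable def prodBase : prod f α ⟶ X := WidePullback.base fun j ↦ toBase f (α j)

/-- The projections of the fibre product of Chow schemes to its factors. -/
noncomputable def prodProj (j : Fin s) : prod f α ⟶ Chow f (α j) :=
  WidePullback.π (fun j ↦ toBase f (α j)) j

instance isAffineHom_prodBase : IsAffineHom (prodBase f α) :=
  isAffineHom_widePullback_base _ _ _

theorem prodProj_toBase (j : Fin s) : prodProj f α j ≫ toBase f (α j) = prodBase f α :=
  WidePullback.π_arrow (fun j ↦ toBase f (α j)) j

theorem prodMk_base : prodMk f α ≫ prodBase f α =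
    CotangentPower.toBase f (Σ j, Fin (α j)) :=
  WidePullback.lift_base _ _ _ _

theorem prodMk_π (j : Fin s) : prodMk f α ≫ prodProj f α j =
    reindex f (Sigma.mk j) ≫ mk f (α j) :=
  WidePullback.lift_π _ _ _ _ _

/-- The map on functions given by the morphism `(z_{j,m}) ↦ (∑_m z_{j,m})_j`. -/
noncomputable def prodMkApp (U : X.Opens) :
    Γ(prod f α, prodBase f α ⁻¹ᵁ U) ⟶
      Γ(CotangentPower f (Σ j, Fin (α j)), CotangentPower.toBase f (Σ j, Fin (α j)) ⁻¹ᵁ U) :=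
  overApp (prodMk f α) (prodMk_base f α) U

theorem projApp_prodMkApp (U : X.Opens) (j : Fin s) :
    overApp (prodProj f α j) (prodProj_toBase f α j) U ≫
      prodMkApp f α U =
    mkApp f (α j) U ≫ reindexApp f (Sigma.mk j : _ → Σ j, Fin (α j)) U := by
  have h : (prodMk f α ≫ prodProj f α j) ≫ toBase f (α j) =
      CotangentPower.toBase f (Σ j, Fin (α j)) := by
    rw [prodMk_π, reindex_mk_toBase]
  rw [prodMkApp, overApp_comp _ _ _ _ h, mkApp_reindexApp]
  exact overApp_congr (prodMk_π f α j) _ _ U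

/-- The fibre product of the Chow schemes is the quotient of the big fibre power by `∏ S_{α_j}`.
Averaging needs every `(α_j)!` to be invertible, which `hunit` provides. -/
theorem prodMkApp_injective_and_mem_range
    (hunit : ∀ (m : ℕ), m ≠ 0 → ∀ U : X.Opens, IsUnit (m : Γ(X, U))) (hU : IsAffineOpen U) :
    Function.Injective (prodMkApp f α U) ∧ ∀ y,
      (∀ g : ∀ j, Equiv.Perm (Fin (α j)),
        reindexApp f (fun x : Σ j, Fin (α j) ↦ ⟨x.1, g x.1 x.2⟩) U y = y) →
      y ∈ Set.range (prodMkApp f α U) := by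
  choose u hu using fun j ↦ (hunit _ (Fintype.card_ne_zero (α := Equiv.Perm (Fin (α j)))) U).exists_left_inv
  have key := injective_and_mem_range_of_coproduct (A := Γ(X, U))
    (fun j ↦ (CotangentPower.toBase f (Fin (α j))).app U) (fun j ↦ (toBase f (α j)).app U)
    ((CotangentPower.toBase f (Σ j, Fin (α j))).app U)
    ((prodBase f α).app U) (fun j ↦ mkApp f (α j) U)
    (fun j ↦ app_mkApp f _ U) (fun j ↦ mkApp_injective f _ hU)
    (fun j (g : Equiv.Perm (Fin (α j))) ↦ reindexApp f g U) (fun j g ↦ app_reindexApp f _ U)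
    (fun j ↦ Equiv.mulLeft) (fun j g h ↦ reindexApp_comp f _ _ U)
    (fun j ↦ mem_range_mkApp f _ hU) u hu
    (fun j ↦ reindexApp f (Sigma.mk j : _ → Σ j, Fin (α j)) U) (fun j ↦ app_reindexApp f _ U)
    (fun T h φ ↦ exists_app_sigma f hU h φ) (fun T H H' ↦ app_sigma_ext f hU H H')
    (fun j ↦ overApp (prodProj f α j) (prodProj_toBase f α j) U)
    (fun j ↦ app_overApp _ _ U) (fun T h φ ↦ exists_widePullback_app _ hU h φ)
    (fun T H H' ↦ widePullback_app_ext _ hU H H') (prodMkApp f α U) (app_overApp _ _ U)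
    (fun j ↦ projApp_prodMkApp f α U j)
  refine ⟨key.1, fun y hy ↦ key.2 y fun g a ha ha' ↦ ?_⟩
  refine Eq.trans ?_ (hy g)
  congr 2
  refine app_sigma_ext f hU _ _ (ha.trans (app_reindexApp f _ U).symm) fun j ↦ (ha' j).trans ?_
  rw [reindexApp_comp, reindexApp_comp]
  rfl

/-- The numerical condition is a count of the pairs of an index `(j, m)` and one of its `j + 1`
repetitions. -/
theorem exists_fiber_ncard {n s : ℕ} {α : Fin s → ℕ}
    (hα : ∑ j : Fin s, ((j : ℕ) + 1) * α j = n) :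
    ∃ r : Fin n → Σ j : Fin s, Fin (α j), ∀ x, (r ⁻¹' {x}).ncard = (x.1 : ℕ) + 1 := by
  have e : Fin n ≃ Σ x : (Σ j : Fin s, Fin (α j)), Fin ((x.1 : ℕ) + 1) := by
    refine Fintype.equivOfCardEq ?_
    simp [Fintype.sum_sigma, ← hα, mul_comm]
  refine ⟨fun i ↦ (e i).1, fun x ↦ ?_⟩
  have h : (fun i ↦ (e i).1) ⁻¹' {x} = e.symm '' (Set.range (Sigma.mk x)) := by
    ext i
    rw [e.symm.image_eq_preimage_symm]
    simp only [Set.mem_preimage, Set.mem_singleton_iff, Equiv.symm_symm, Set.mem_range]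
    constructor
    · rintro rfl
      exact ⟨(e i).2, rfl⟩
    · rintro ⟨y, hy⟩
      rw [← hy]
  rw [h, Set.ncard_image_of_injective _ e.symm.injective, ← Set.image_univ,
    Set.ncard_image_of_injective _ sigma_mk_injective]
  simp

theorem exists_isWeightedSum
    (hunit : ∀ (m : ℕ), m ≠ 0 → ∀ U : X.Opens, IsUnit (m : Γ(X, U))) {n s : ℕ} {α : Fin s → ℕ}
    (hα : ∑ j : Fin s, ((j : ℕ) + 1) * α j = n) :
    ∃ τ : prod f α ⟶ Chow f n, IsWeightedSum f τ := by
  obtain ⟨r, hr⟩ := exists_fiber_ncard hα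
  have hperm {r' : Fin n → Σ j : Fin s, Fin (α j)}
      (hr' : ∀ x, (r' ⁻¹' {x}).ncard = (x.1 : ℕ) + 1) :
      reindex f r' ≫ mk f n = reindex f r ≫ mk f n := by
    obtain ⟨g, rfl⟩ := exists_equiv_comp_eq r' r fun x ↦ (hr' x).trans (hr x).symm
    rw [← reindex_comp, Category.assoc, reindex_mk]
  -- Permuting the points of each multiplicity turns `r` into another map with the same fibre sizes,
  -- which by `hperm` gives the same cycle. The pulled-back functions are thus invariant under `∏
  -- S_{α_j}` and descend to the product of Chow schemes.
  have hrange (U : X.Opens) (hU : IsAffineOpen U) (x) :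
      (mkApp f n U ≫ reindexApp f r U) x ∈ Set.range (prodMkApp f α U) := by
    refine (prodMkApp_injective_and_mem_range f α hunit hU).2 _ fun g ↦ ?_
    let G : Equiv.Perm (Σ j, Fin (α j)) := Equiv.sigmaCongrRight g
    have h : (∀ x, ((G ∘ r) ⁻¹' {x}).ncard = (x.1 : ℕ) + 1) := fun x ↦ by
      have hx := hr (G.symm x)
      rw [Set.preimage_comp, show G ⁻¹' {x} = {G.symm x} by ext; simp [Equiv.eq_symm_apply]]
      exact hx
    have key : (mkApp f n U ≫ reindexApp f r U) ≫ reindexApp f G U =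
        mkApp f n U ≫ reindexApp f r U := by
      rw [Category.assoc, reindexApp_comp, mkApp_reindexApp, mkApp_reindexApp]
      exact overApp_congr (hperm h) _ _ U
    exact congr($key x)
  choose θ hθ using fun U hU ↦ exists_comp_eq_of_range_subset (prodMkApp f α U)
    (prodMkApp_injective_and_mem_range f α hunit hU).1 _ (hrange U hU)
  have hinj {U : X.Opens} (hU : IsAffineOpen U) :=
    (prodMkApp_injective_and_mem_range f α hunit hU).1
  obtain ⟨τ, hτ, hτ'⟩ := exists_lift f (prodBase f α) θ (by
    intro U V hU hV i
    refine comp_injective_cancel (hinj hU) ?_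
    rw [Category.assoc, Category.assoc, hθ]
    have h1 := overApp_map (prodMk f α) (prodMk_base f α) i
    refine Eq.trans ?_ (congrArg (θ V hV ≫ ·) h1)
    change _ = θ V hV ≫ prodMkApp f α V ≫ _
    rw [reassoc_of% hθ V hV, mkApp_reindexApp, ← Category.assoc (mkApp f n V), mkApp_reindexApp]
    exact (overApp_map _ (reindex_mk_toBase f r) i).symm) (by
    intro U hU
    refine comp_injective_cancel (hinj hU) ?_
    rw [Category.assoc, hθ, mkApp_reindexApp, prodMkApp, app_overApp]
    exact (app_overApp _ _ _).symm)
  refine ⟨τ, hτ, fun r' hr' ↦ Eq.trans ?_ (hperm hr').symm⟩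
  have h : (prodMk f α ≫ τ) ≫ toBase f n = CotangentPower.toBase f _ := by
    rw [Category.assoc, hτ, prodMk_base]
  refine hom_ext_of_overApp h (reindex_mk_toBase f r) fun U hU ↦ ?_
  rw [← overApp_comp _ _ (prodMk_base f α) hτ h, ← mkApp_reindexApp, ← hθ U hU,
    ← hτ' U hU (hU.preimage _)]
  rfl

end Chow
end Tau

/-! ### The geometric generic point and the Galois action. -/

section GenericPoint
variable (X : Scheme.{u}) [IsIntegral X]

/-- An algebraic closure of the function field of `X`. -/
abbrev GeomField : Type u := AlgebraicClosure X.functionField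

/-- The inclusion of the local ring at the generic point into the algebraic closure of the function
field. -/
noncomputable def stalkToGeomField :
    X.presheaf.stalk (genericPoint X) ⟶ .of (GeomField X) :=
  CommRingCat.ofHom (algebraMap X.functionField (GeomField X))

/-- The geometric generic point of `X`. -/
noncomputable def geomPoint : Spec (.of (GeomField X)) ⟶ X :=
  Spec.map (stalkToGeomField X) ≫ X.fromSpecStalk (genericPoint X)

variable {X} in
/-- The value of functions at the geometric generic point. -/
noncomputable def geomEval {U : X.Opens} (h : genericPoint X ∈ U) :
    Γ(X, U) ⟶ .of (GeomField X) :=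
  X.presheaf.germ U (genericPoint X) h ≫ stalkToGeomField X

variable {X} {U V : X.Opens} (h : genericPoint X ∈ U)

theorem spec_map_geomEval_fromSpec (hU : IsAffineOpen U) :
    Spec.map (geomEval h) ≫ hU.fromSpec = geomPoint X := by
  rw [geomEval, Spec.map_comp, Category.assoc, geomPoint, ← hU.fromSpecStalk_eq_fromSpecStalk h]
  rfl

theorem geomEval_injective : Function.Injective (geomEval h) :=
  (algebraMap X.functionField (GeomField X)).injective.comp (germ_injective_of_isIntegral X _ h)

theorem map_geomEval (h : genericPoint X ∈ U) (h' : genericPoint X ∈ V) (i : U ≤ V) :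
    X.presheaf.map (homOfLE i).op ≫ geomEval h = geomEval h' := by
  rw [geomEval, TopCat.Presheaf.germ_res_assoc, geomEval]

theorem geomPoint_apply (y : Spec (.of (GeomField X))) : geomPoint X y = genericPoint X := by
  have h1 : Spec.map (stalkToGeomField X) y =
      IsLocalRing.closedPoint X.functionField := Subsingleton.elim (α := PrimeSpectrum X.functionField) _ _
  rw [geomPoint, Scheme.Hom.comp_apply, h1]
  exact Scheme.fromSpecStalk_closedPoint

instance isDominant_geomPoint : IsDominant (geomPoint X) := by
  refine ⟨(dense_iff_closure_eq.2 (genericPoint_closure (α := X))).mono ?_⟩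
  rintro _ rfl
  exact ⟨default, geomPoint_apply _⟩

/-- The action of the absolute Galois group of the function field. -/
noncomputable def galSpec (σ : Gal(GeomField X/X.functionField)) :
    Spec (.of (GeomField X)) ⟶ Spec (.of (GeomField X)) :=
  Spec.map (CommRingCat.ofHom (σ : GeomField X →+* GeomField X))

theorem galSpec_geomPoint (σ : Gal(GeomField X/X.functionField)) :
    galSpec σ ≫ geomPoint X = geomPoint X := by
  rw [galSpec, geomPoint, ← Spec.map_comp_assoc]
  congr 2
  ext y
  exact σ.commutes y

instance isIso_galSpec (σ : Gal(GeomField X/X.functionField)) : IsIso (galSpec σ) := by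
  have : IsIso (CommRingCat.ofHom (σ : GeomField X →+* GeomField X)) :=
    (ConcreteCategory.isIso_iff_bijective _).2 σ.bijective
  rw [galSpec]
  infer_instance

/-- In characteristic zero the Galois-fixed elements form the function field, and there normality of
`Γ(X, U)` applies. -/
theorem mem_range_geomEval [CharZero X.functionField] (hU : IsAffineOpen U)
    [IsIntegrallyClosed Γ(X, U)] (y : GeomField X)
    (hy : (geomEval h).hom.IsIntegralElem y)
    (hσ : ∀ σ : Gal(GeomField X/X.functionField), σ y = y) : y ∈ Set.range (geomEval h) := by
  have : Nonempty U := ⟨⟨_, h⟩⟩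
  obtain ⟨z, rfl⟩ := (InfiniteGalois.mem_range_algebraMap_iff_fixed y).2 hσ
  have := functionField_isFractionRing_of_isAffineOpen X U hU
  obtain ⟨P, hP, hP'⟩ := hy
  obtain ⟨w, hw⟩ := IsIntegrallyClosed.isIntegral_iff (R := Γ(X, U)).1 (show IsIntegral Γ(X, U) z from ⟨P, hP, by
    refine (algebraMap X.functionField (GeomField X)).injective ?_
    rw [map_zero, Polynomial.hom_eval₂]
    exact hP'⟩)
  exact ⟨w, congrArg (algebraMap X.functionField (GeomField X)) hw⟩

theorem subsingleton_of_genericPoint_notMem (h : genericPoint X ∉ U) : Subsingleton Γ(X, U) := by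
  obtain rfl : U = ⊥ := by
    by_contra hU
    obtain ⟨y, hy⟩ := (TopologicalSpace.Opens.ne_bot_iff_nonempty U).1 hU
    exact h ((genericPoint_specializes y).mem_open U.2 hy)
  infer_instance
end GenericPoint

/-! ### Change of field for field-valued points. -/

section FieldLemma

/-- Injectivity of `h` embeds `K` in `E`. Since `μ` is integral, `φ` takes values algebraic over
`K`; the algebraic closure of `K` in `E` can serve as `M`, and it embeds in `L` over `K`. -/
theorem exists_factor_through_algebraic {A C D E K L : Type u} [CommRing A] [CommRing C]
    [CommRing D] [Field E] [Field K] [Field L] [Algebra A K] [IsFractionRing A K] [Algebra K L]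
    [IsAlgClosed L] (φ : D →+* E) (μ : C →+* D) (hμ : μ.IsIntegral) (h : A →+* E)
    (hh : Function.Injective h) (a : C →+* A) (hφ : φ.comp μ = h.comp a) :
    ∃ (M : Type u) (_ : Field M) (φ' : D →+* M) (v : M →+* E) (j : M →+* L),
      v.comp φ' = φ ∧ (j.comp φ').comp μ = ((algebraMap K L).comp (algebraMap A K)).comp a := by
  let := (IsFractionRing.lift hh : K →+* E).toAlgebra
  have hKE : ∀ x, algebraMap K E (algebraMap A K x) = h x := IsFractionRing.lift_algebraMap hh
  have hmem : ∀ d, φ d ∈ (algebraicClosure K E).toSubalgebra.toSubring := fun d ↦ by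
    obtain ⟨P, hP, hP'⟩ := hμ d
    refine mem_algebraicClosure_iff.2 (IsIntegral.isAlgebraic
      ⟨P.map ((algebraMap A K).comp a), hP.map _, ?_⟩)
    rw [Polynomial.eval₂_map]
    have : (algebraMap K E).comp ((algebraMap A K).comp a) = φ.comp μ := by
      rw [hφ]; ext x; exact hKE _
    rw [this, ← Polynomial.hom_eval₂, hP', map_zero]
  let j : algebraicClosure K E →ₐ[K] L := IsAlgClosed.lift
  let φ' : D →+* algebraicClosure K E := φ.codRestrict (algebraicClosure K E).toSubalgebra.toSubring hmem
  refine ⟨algebraicClosure K E, inferInstance, φ', (algebraicClosure K E).val.toRingHom,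
    j.toRingHom, rfl, ?_⟩
  ext c
  have : φ' (μ c) = algebraMap K _ (algebraMap A K (a c)) := by
    refine Subtype.ext ?_
    change φ (μ c) = algebraMap K E (algebraMap A K (a c))
    rw [hKE]
    exact congr($hφ c)
  change j (φ' (μ c)) = _
  rw [this]
  exact j.commutes _

/-- A field extension is faithfully flat. Equality of field-valued points can therefore be tested
after any extension. -/
theorem epi_spec_map_of_field {M E : Type u} [Field M] [Field E] (v : M →+* E) :
    Epi (Spec.map (CommRingCat.ofHom v)) := by
  have : Flat (Spec.map (CommRingCat.ofHom v)) := by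
    rw [Flat.SpecMap_iff]
    let := v.toAlgebra
    exact inferInstanceAs (Module.Flat M E)
  have : Surjective (Spec.map (CommRingCat.ofHom v)) :=
    ⟨fun y ↦ ⟨(default : PrimeSpectrum E), Subsingleton.elim (α := PrimeSpectrum M) _ _⟩⟩
  exact Flat.epi_of_flat_of_surjective _
end FieldLemma

/-! ### Extending sections from the geometric generic point. -/

section Descent
variable {S X : Scheme.{u}} (f : X ⟶ S) [IsAffine S] [Smooth f]
open CotangentPower

variable {f} in
theorem SpectralDatum.le_preimage {n : ℕ} (a : SpectralDatum f n) (U : X.Opens) :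
    U ≤ a.hom ⁻¹ᵁ (Chow.toBase f n) ⁻¹ᵁ U :=
  preimage_le_preimage_preimage a.hom a.hom_toBase U

variable {f} in
/-- The map on functions given by a spectral datum. -/
noncomputable def SpectralDatum.app {n : ℕ} (a : SpectralDatum f n) (U : X.Opens) :
    Γ(Chow f n, Chow.toBase f n ⁻¹ᵁ U) ⟶ Γ(X, U) :=
  a.hom.appLE _ U (a.le_preimage U)

theorem SpectralDatum.fromSpec_hom {n : ℕ} (a : SpectralDatum f n) {U : X.Opens}
    (hU : IsAffineOpen U) :
    Spec.map (a.app U) ≫ (hU.preimage (Chow.toBase f n)).fromSpec = hU.fromSpec ≫ a.hom :=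
  (hU.preimage (Chow.toBase f n)).SpecMap_appLE_fromSpec a.hom hU _

theorem SpectralDatum.toBase_app {n : ℕ} (a : SpectralDatum f n) (U : X.Opens) :
    (Chow.toBase f n).app U ≫ a.app U = 𝟙 _ := by
  refine (app_overApp a.hom a.hom_toBase U).trans ?_
  rw [Scheme.Hom.id_app]

theorem SpectralDatum.exists_of_app {n : ℕ}
    (θ : ∀ U : X.Opens, IsAffineOpen U → (Γ(Chow f n, Chow.toBase f n ⁻¹ᵁ U) ⟶ Γ(X, U)))
    (hθ : ∀ (U V : X.Opens) (hU : IsAffineOpen U) (hV : IsAffineOpen V) (i : U ≤ V),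
      (Chow f n).presheaf.map (homOfLE ((Chow.toBase f n).preimage_mono i)).op ≫ θ U hU =
      θ V hV ≫ X.presheaf.map (homOfLE i).op)
    (hα : ∀ U hU, (Chow.toBase f n).app U ≫ θ U hU = 𝟙 _) :
    ∃ b : SpectralDatum f n, ∀ U hU, b.app U = θ U hU := by
  obtain ⟨b, hb, hb'⟩ := Chow.exists_lift f (𝟙 X) θ hθ fun U hU ↦
    (hα U hU).trans (Scheme.Hom.id_app U).symm
  exact ⟨⟨b, hb⟩, fun U hU ↦ hb' U hU hU⟩

variable [IsIntegral X]

theorem SpectralDatum.geomPoint_hom {n : ℕ} (a : SpectralDatum f n) {U : X.Opens}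
    (h : genericPoint X ∈ U) (hU : IsAffineOpen U) :
    Spec.map (a.app U ≫ geomEval h) ≫ (hU.preimage (Chow.toBase f n)).fromSpec =
      geomPoint X ≫ a.hom := by
  rw [Spec.map_comp, Category.assoc, a.fromSpec_hom, ← spec_map_geomEval_fromSpec h hU,
    Category.assoc]

theorem exists_isAffineOpen_genericPoint_mem :
    ∃ U : X.Opens, IsAffineOpen U ∧ genericPoint X ∈ U := by
  obtain ⟨_, ⟨U, hU, rfl⟩, h, -⟩ := X.isBasis_affineOpens.exists_subset_of_mem_open
    (Set.mem_univ (genericPoint X)) isOpen_univ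
  exact ⟨U, hU, h⟩

/-- The geometric generic point is dominant, `X` is reduced, and the Chow scheme is affine, hence
separated, over `X`. -/
theorem eq_of_comp_geomPoint {n : ℕ} {g g' : X ⟶ Chow f n} (h : g ≫ Chow.toBase f n = 𝟙 X)
    (h' : g' ≫ Chow.toBase f n = 𝟙 X) (hg : geomPoint X ≫ g = geomPoint X ≫ g') : g = g' :=
  ext_of_isDominant_of_isSeparated (Chow.toBase f n) (h.trans h'.symm) (geomPoint X) hg

/-- A geometric generic point of the Chow scheme whose coordinates are regular on `X` extends to
a spectral datum. -/
theorem exists_spectralDatum {n : ℕ} (m : Spec (.of (GeomField X)) ⟶ Chow f n)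
    (hm : m ≫ Chow.toBase f n = geomPoint X)
    (hrange : ∀ (U : X.Opens) (hU : IsAffineOpen U) (h : genericPoint X ∈ U)
      (φ : Γ(Chow f n, Chow.toBase f n ⁻¹ᵁ U) ⟶ .of (GeomField X)),
      Spec.map φ ≫ (hU.preimage (Chow.toBase f n)).fromSpec = m →
      ∀ c, φ c ∈ Set.range (geomEval h)) :
    ∃ b : SpectralDatum f n, geomPoint X ≫ b.hom = m := by
  have hex (U : X.Opens) (hU : IsAffineOpen U) :
      ∃ θ : Γ(Chow f n, Chow.toBase f n ⁻¹ᵁ U) ⟶ Γ(X, U), ∀ h : genericPoint X ∈ U,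
        Spec.map (θ ≫ geomEval h) ≫ (hU.preimage (Chow.toBase f n)).fromSpec = m := by
    by_cases h : genericPoint X ∈ U
    · obtain ⟨φ, hφ, -⟩ := exists_spec_map_preimage_fromSpec (Chow.toBase f n) hU m (geomEval h)
        (hm.trans (spec_map_geomEval_fromSpec h hU).symm)
      obtain ⟨θ, hθ⟩ := exists_comp_eq_of_range_subset (geomEval h) (geomEval_injective h) φ
        (hrange U hU h φ hφ)
      exact ⟨θ, fun _ ↦ by rw [hθ, hφ]⟩
    -- Here `U` is empty and `Γ(X, U)` is the zero ring, so the zero map is a ring homomorphism.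
    · have := subsingleton_of_genericPoint_notMem h
      exact ⟨CommRingCat.ofHom
        { toFun := fun _ ↦ 0
          map_one' := Subsingleton.elim _ _
          map_mul' := fun _ _ ↦ Subsingleton.elim _ _
          map_zero' := rfl
          map_add' := fun _ _ ↦ Subsingleton.elim _ _ }, fun h' ↦ absurd h' h⟩
  choose θ hθ using hex
  have hsub {R : CommRingCat.{u}} {U : X.Opens} (h : genericPoint X ∉ U) (a b : R ⟶ Γ(X, U)) :
      a = b := by
    have := subsingleton_of_genericPoint_notMem h
    ext x
    exact Subsingleton.elim _ _
  obtain ⟨b, hb⟩ := SpectralDatum.exists_of_app f θ (by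
    intro U V hU hV i
    by_cases h : genericPoint X ∈ U
    · refine comp_injective_cancel (geomEval_injective h)
        (spec_map_fromSpec_inj (hV.preimage (Chow.toBase f n)) ?_)
      rw [Category.assoc, Category.assoc, map_geomEval h (i h), hθ V hV (i h), Spec.map_comp,
        Category.assoc, IsAffineOpen.map_fromSpec _ (hU.preimage (Chow.toBase f n)), hθ U hU h]
    · exact hsub h _ _) (by
    intro U hU
    by_cases h : genericPoint X ∈ U
    · refine comp_injective_cancel (geomEval_injective h) (spec_map_fromSpec_inj hU ?_)
      rw [Category.assoc, Spec.map_comp, Category.assoc, spec_map_app_fromSpec _ hU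
        (hU.preimage (Chow.toBase f n)), reassoc_of% hθ U hU h, hm, Category.id_comp,
        spec_map_geomEval_fromSpec]
    · exact hsub h _ _)
  refine ⟨b, ?_⟩
  obtain ⟨U, hU, h⟩ := exists_isAffineOpen_genericPoint_mem (X := X)
  rw [← SpectralDatum.geomPoint_hom f b h hU, hb U hU]
  exact hθ U hU h

end Descent

/-! ### Blocks of equal points and their permutations. -/

section Combinatorics

/-- A setoid with prescribed numbers of classes of each cardinality is the kernel of a map to the
corresponding standard set. -/
theorem exists_map_of_classes {n s : ℕ} {α : Fin s → ℕ} (R : Setoid (Fin n))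
    (h₁ : ∀ c ∈ R.classes, c.ncard ≤ s)
    (h₂ : ∀ j : Fin s, {c ∈ R.classes | c.ncard = (j : ℕ) + 1}.ncard = α j) :
    ∃ r : Fin n → Σ j : Fin s, Fin (α j), (∀ x, (r ⁻¹' {x}).ncard = (x.1 : ℕ) + 1) ∧
      ∀ i i', r i = r i' ↔ R i i' := by
  have hpos : ∀ c ∈ R.classes, 0 < c.ncard := fun c hc ↦
    (Set.ncard_pos).2 (Setoid.nonempty_of_mem_partition (Setoid.isPartition_classes R) hc)
  -- The index `j : Fin s` stands for multiplicity `j + 1`; classes are nonempty, so the subtraction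
  -- loses nothing.
  let ty (c : R.classes) : Fin s := ⟨c.1.ncard - 1, by have := h₁ _ c.2; have := hpos _ c.2; omega⟩
  have hty (c : R.classes) (j : Fin s) : ty c = j ↔ c.1.ncard = (j : ℕ) + 1 := by
    have := hpos _ c.2
    rw [Fin.ext_iff]
    change c.1.ncard - 1 = _ ↔ _
    omega
  have hE (j : Fin s) : Nonempty ({c : R.classes // ty c = j} ≃ Fin (α j)) := by
    refine Finite.card_eq.1 ?_
    rw [Nat.card_eq_fintype_card (α := Fin (α j)), Fintype.card_fin, ← h₂ j,
      ← Nat.card_coe_set_eq]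
    refine Nat.card_congr ((Equiv.subtypeSubtypeEquivSubtypeInter _ _).symm.trans
      (Equiv.subtypeEquivRight fun c ↦ (hty c j).symm)).symm
  let E : R.classes ≃ Σ j : Fin s, Fin (α j) :=
    (Equiv.sigmaFiberEquiv ty).symm.trans (Equiv.sigmaCongrRight fun j ↦ (hE j).some)
  have hE1 (c : R.classes) : (E c).1 = ty c := rfl
  let cl (i : Fin n) : R.classes := ⟨{x | R x i}, R.mem_classes i⟩
  have hcl (i : Fin n) (c : R.classes) : cl i = c ↔ i ∈ c.1 := by
    constructor
    · rintro rfl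
      exact R.refl i
    · intro hi
      exact Subtype.ext (Setoid.eq_of_mem_classes (R.mem_classes i) (R.refl i) c.2 hi)
  refine ⟨fun i ↦ E (cl i), fun x ↦ ?_, fun i i' ↦ ?_⟩
  · have : (fun i ↦ E (cl i)) ⁻¹' {x} = (E.symm x).1 := by
      ext i
      rw [← hcl, Set.mem_preimage, Set.mem_singleton_iff, Equiv.eq_symm_apply]
    rw [this, ← hty, ← hE1, E.apply_symm_apply]
  · rw [E.injective.eq_iff, hcl]
    rfl

/-- A permutation compatible with the fibres of `r` carries fibres onto fibres of the same size, and
the size determines `j`. It thus permutes the fibres over the points `(j, m)` for each fixed `j`. -/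
theorem exists_perm_of_fibers {n s : ℕ} {α : Fin s → ℕ} {r : Fin n → Σ j : Fin s, Fin (α j)}
    (hr : ∀ x, (r ⁻¹' {x}).ncard = (x.1 : ℕ) + 1) (g : Equiv.Perm (Fin n))
    (hg : ∀ i i', r i = r i' ↔ r (g i) = r (g i')) (sec : (Σ j : Fin s, Fin (α j)) → Fin n)
    (hsec : ∀ x, r (sec x) = x) (j : Fin s) :
    ∃ π : Equiv.Perm (Fin (α j)), ∀ m, r (g (sec ⟨j, m⟩)) = ⟨j, π m⟩ := by
  let P (x : Σ j : Fin s, Fin (α j)) := r (g (sec x))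
  have hP (x) : (P x).1 = x.1 := by
    have h : r ⁻¹' {P x} = g '' (r ⁻¹' {x}) := by
      ext i
      rw [Equiv.image_eq_preimage_symm]
      simp only [Set.mem_preimage, Set.mem_singleton_iff]
      conv_rhs => rw [← hsec x, hg, Equiv.apply_symm_apply]
    have h' := hr (P x)
    rw [h, Set.ncard_image_of_injective _ g.injective, hr] at h'
    exact Fin.ext (by omega)
  have hex (m : Fin (α j)) : ∃ m', P ⟨j, m⟩ = ⟨j, m'⟩ := by
    have h := hP ⟨j, m⟩
    generalize P ⟨j, m⟩ = y at h
    obtain ⟨j', m'⟩ := y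
    obtain rfl : j' = j := h
    exact ⟨m', rfl⟩
  choose π hπ using hex
  have hinj : Function.Injective π := fun m m' h ↦ by
    have h1 : P ⟨j, m⟩ = P ⟨j, m'⟩ := by rw [hπ, hπ, h]
    have h2 := (hg _ _).2 h1
    rw [hsec, hsec] at h2
    simpa using h2
  exact ⟨Equiv.ofBijective π (Finite.injective_iff_bijective.1 hinj), hπ⟩

end Combinatorics

/-! ### Lifting a spectral datum to a tuple of geometric points. -/

section Points

theorem mem_asIdeal_iff_of_isField {E : CommRingCat.{u}} (hE : IsField E) (y : Spec E) (x : E) :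
    x ∈ PrimeSpectrum.asIdeal y ↔ x = 0 := by
  refine ⟨fun hx ↦ by_contra fun h ↦ ?_, fun hx ↦ hx ▸ Ideal.zero_mem _⟩
  obtain ⟨b, hb⟩ := hE.mul_inv_cancel h
  exact (Ideal.ne_top_iff_one _).1 (PrimeSpectrum.isPrime y).ne_top
    (hb ▸ Ideal.mul_mem_right b _ hx)

/-- Two field-valued points with the same underlying point have the same kernel. -/
theorem apply_eq_zero_iff_of_fromSpec_eq {Y : Scheme.{u}} {V : Y.Opens} (hV : IsAffineOpen V)
    {E E' : CommRingCat.{u}} (hE : IsField E) (hE' : IsField E') (φ : Γ(Y, V) ⟶ E)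
    (ψ : Γ(Y, V) ⟶ E') (y : Spec E) (y' : Spec E')
    (h : (Spec.map φ ≫ hV.fromSpec) y = (Spec.map ψ ≫ hV.fromSpec) y') (c : Γ(Y, V)) :
    φ c = 0 ↔ ψ c = 0 := by
  have h' : Spec.map φ y = Spec.map ψ y' := hV.fromSpec.isOpenEmbedding.injective h
  rw [← mem_asIdeal_iff_of_isField hE y, ← mem_asIdeal_iff_of_isField hE' y']
  change c ∈ PrimeSpectrum.asIdeal (Spec.map φ y) ↔ c ∈ PrimeSpectrum.asIdeal (Spec.map ψ y')
  rw [h']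

variable {S X : Scheme.{u}} (f : X ⟶ S) [IsAffine S] [Smooth f]
open CotangentPower

/-- The range is the ring of invariants, over which every function is integral; the monic equation
is then lifted from the range to the source. -/
theorem Chow.isIntegral_mkApp (n : ℕ) {U : X.Opens} (hU : IsAffineOpen U) :
    (mkApp f n U).hom.IsIntegral := by
  have h := isIntegral_subtype_of_forall_mem_iff
    (fun g : Equiv.Perm (Fin n) ↦ (reindexApp f g U).hom) Equiv.mulLeft
    (fun g h x ↦ congr($(reindexApp_comp f g h U) x)) 1
    (fun x ↦ congr($(reindexApp_id f U) x)) (mkApp f n U).hom.range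
    fun x ↦ Chow.mem_range_mkApp f n hU x
  intro d
  obtain ⟨P, hP, hP'⟩ := h d
  obtain ⟨Q, hQ, -, hQ'⟩ := Polynomial.lifts_and_natDegree_eq_and_monic
    (Polynomial.map_surjective (mkApp f n U).hom.rangeRestrict
      (RingHom.rangeRestrict_surjective _) P) hP
  refine ⟨Q, hQ', ?_⟩
  rw [← hQ, Polynomial.eval₂_map] at hP'
  exact hP'

variable [IsIntegral X]

/-- Over an affine neighbourhood of the generic point both tuples are ring homomorphisms that agree
on the `S_n`-invariants, so `exists_eq_comp_of_eqOn_invariants` applies. The infinite field of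
constants comes from `c`. -/
theorem exists_reindex_of_mk_eq {n : ℕ} {k : Type*} [Field k] [Infinite k]
    (c : ∀ U : X.Opens, k →+* Γ(X, U))
    (ζ ζ' : Spec (.of (GeomField X)) ⟶ CotangentPower f (Fin n))
    (hζ : ζ ≫ toBase f (Fin n) = geomPoint X) (h : ζ ≫ Chow.mk f n = ζ' ≫ Chow.mk f n) :
    ∃ g : Equiv.Perm (Fin n), ζ' = ζ ≫ reindex f g := by
  have hζ' : ζ' ≫ toBase f (Fin n) = geomPoint X := by
    rw [← Chow.mk_toBase, ← reassoc_of% h, Chow.mk_toBase, hζ]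
  obtain ⟨U, hU, hη⟩ := exists_isAffineOpen_genericPoint_mem (X := X)
  obtain ⟨φ, hφ, hφ'⟩ := exists_spec_map_preimage_fromSpec (toBase f (Fin n)) hU ζ (geomEval hη)
    (hζ.trans (spec_map_geomEval_fromSpec hη hU).symm)
  obtain ⟨ψ, hψ, hψ'⟩ := exists_spec_map_preimage_fromSpec (toBase f (Fin n)) hU ζ' (geomEval hη)
    (hζ'.trans (spec_map_geomEval_fromSpec hη hU).symm)
  have hmk : Chow.mkApp f n U ≫ φ = Chow.mkApp f n U ≫ ψ := by
    refine spec_map_fromSpec_inj (hU.preimage (Chow.toBase f n)) ?_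
    rw [Chow.mkApp, Spec.map_comp, Spec.map_comp, Category.assoc, Category.assoc,
      spec_map_overApp_fromSpec _ _ _ (hU.preimage (toBase f (Fin n))), reassoc_of% hφ,
      reassoc_of% hψ, h]
  obtain ⟨g, hg⟩ := exists_eq_comp_of_eqOn_invariants
    (((toBase f (Fin n)).app U).hom.comp (c U))
    (fun g : Equiv.Perm (Fin n) ↦ (reindexApp f g U).hom) Equiv.mulLeft
    (fun g h x ↦ congr($(reindexApp_comp f g h U) x)) 1
    (fun x ↦ congr($(reindexApp_id f U) x))
    (fun g t ↦ congr($(app_reindexApp f g U) (c U t))) φ.hom ψ.hom (fun x hx ↦ by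
      obtain ⟨y, rfl⟩ := (Chow.mem_range_mkApp f n hU x).2 hx
      exact congr($hmk y))
  refine ⟨g, ?_⟩
  have hg' : ψ = reindexApp f g U ≫ φ := by ext x; exact congr($hg x)
  rw [← hψ, hg', Spec.map_comp, Category.assoc, reindexApp,
    spec_map_overApp_fromSpec _ _ _ (hU.preimage (toBase f (Fin n))), reassoc_of% hφ]

/-- A spectral datum at the geometric generic point is given by a tuple of points with the
prescribed coincidences. -/
theorem exists_geomPoint_lift {n : ℕ} (a : SpectralDatum f n) (p : CotangentPower f (Fin n))
    (hp : Chow.mk f n p = a.hom (genericPoint X)) :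
    ∃ ζ : Spec (.of (GeomField X)) ⟶ CotangentPower f (Fin n),
      ζ ≫ Chow.mk f n = geomPoint X ≫ a.hom ∧
      ∀ i i', ζ ≫ proj f i = ζ ≫ proj f i' ↔ Chow.coincidence p i i' := by
  obtain ⟨U, hU, hη⟩ := exists_isAffineOpen_genericPoint_mem (X := X)
  have hU' := hU.preimage (toBase f (Fin n))
  have hU'' := hU.preimage (Chow.toBase f n)
  have hpη : toBase f (Fin n) p = genericPoint X := by
    rw [← Chow.mk_toBase, Scheme.Hom.comp_apply, hp, ← Scheme.Hom.comp_apply, a.hom_toBase]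
    rfl
  let t := (CotangentPower f (Fin n)).fromSpecResidueField p
  have htp (y) : t y = p := Scheme.fromSpecResidueField_apply _ _
  obtain ⟨φ, hφ⟩ := exists_spec_map_fromSpec hU' t (by
    rintro _ ⟨y, rfl⟩
    rw [htp]
    change toBase f (Fin n) p ∈ U
    rwa [hpη])
  let h := (toBase f (Fin n)).app U ≫ φ
  have hh : Spec.map h ≫ hU.fromSpec = t ≫ toBase f (Fin n) := by
    rw [Spec.map_comp, Category.assoc, spec_map_app_fromSpec _ hU hU', reassoc_of% hφ]
  let y₀ : Spec ((CotangentPower f (Fin n)).residueField p) := (default : PrimeSpectrum _)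
  let y₁ : Spec (.of (GeomField X)) := (default : PrimeSpectrum _)
  have hE : IsField ((CotangentPower f (Fin n)).residueField p) := Field.toIsField _
  -- The point `p` lies over the generic point, so `h` has the same kernel as `geomEval`, namely
  -- zero.
  have hinj : Function.Injective h := (injective_iff_map_eq_zero h.hom).2 fun c hc ↦ by
    refine (map_eq_zero_iff _ (geomEval_injective hη)).1
      ((apply_eq_zero_iff_of_fromSpec_eq hU hE (Field.toIsField (GeomField X)) h (geomEval hη)
        y₀ y₁ ?_ c).1 hc)
    rw [hh, spec_map_geomEval_fromSpec, geomPoint_apply, Scheme.Hom.comp_apply, htp, hpη]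
  have hφmk : Spec.map (Chow.mkApp f n U ≫ φ) ≫ hU''.fromSpec = t ≫ Chow.mk f n := by
    rw [Chow.mkApp, Spec.map_comp, Category.assoc, spec_map_overApp_fromSpec _ _ _ hU',
      reassoc_of% hφ]
  have hker (c) : (Chow.mkApp f n U ≫ φ) c = 0 ↔ (a.app U ≫ h) c = 0 := by
    refine apply_eq_zero_iff_of_fromSpec_eq hU'' hE hE _ _ y₀ y₀ ?_ c
    rw [hφmk, Spec.map_comp, Category.assoc, a.fromSpec_hom f hU, reassoc_of% hh]
    simp only [Scheme.Hom.comp_apply, htp, hp, hpη]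
  -- `hker` only equates kernels, because both maps represent the point `a(η)`, with `η` the generic
  -- point. Since `a` is a section, `c` minus the pullback of `a.app U c` lies in the kernel of
  -- `a.app U`, and equal kernels become equal maps.
  have hfac : Chow.mkApp f n U ≫ φ = a.app U ≫ h := by
    ext c
    have h1 : (Chow.mkApp f n U ≫ φ) ((Chow.toBase f n).app U (a.app U c)) = h (a.app U c) :=
      congr(φ ($(Chow.app_mkApp f n U) (a.app U c)))
    have h2 : a.app U ((Chow.toBase f n).app U (a.app U c)) = a.app U c :=
      congr($(a.toBase_app f U) (a.app U c))
    rw [← sub_eq_zero]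
    have h3 := (hker (c - (Chow.toBase f n).app U (a.app U c))).2 (by
      change h (a.app U _) = 0
      rw [map_sub, h2, sub_self, map_zero])
    rw [map_sub, h1] at h3
    exact h3
  have : Nonempty U := ⟨⟨_, hη⟩⟩
  have := functionField_isFractionRing_of_isAffineOpen X U hU
  -- The residue field of `p` carries no chosen embedding into `GeomField X`. The tuple is therefore
  -- defined over the field `M` of elements algebraic over the function field, and moved from there
  -- along `j`.
  obtain ⟨M, _, φ', v, j, hv, hj⟩ := exists_factor_through_algebraic
    (K := X.functionField) (L := GeomField X) φ.hom (Chow.mkApp f n U).hom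
    (Chow.isIntegral_mkApp f n hU) h.hom hinj (a.app U).hom congr(($hfac).hom)
  obtain ⟨ζM, hζM⟩ : ∃ ζM : Spec (.of M) ⟶ CotangentPower f (Fin n),
    ζM = Spec.map (CommRingCat.ofHom φ') ≫ hU'.fromSpec := ⟨_, rfl⟩
  have htM : t = Spec.map (CommRingCat.ofHom v) ≫ ζM := by
    rw [hζM, ← Spec.map_comp_assoc, ← hφ, ← CommRingCat.ofHom_comp, hv]
    rfl
  -- As both field extensions of `M` induce epimorphisms of spectra, the coincidences over the
  -- residue field, over `M` and over `GeomField X` are the same.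
  have := epi_spec_map_of_field v
  have := epi_spec_map_of_field j
  refine ⟨Spec.map (CommRingCat.ofHom j) ≫ ζM, ?_, fun i i' ↦ ?_⟩
  · rw [hζM, ← a.geomPoint_hom f hη hU, Category.assoc, Category.assoc,
      ← spec_map_overApp_fromSpec _ (Chow.mk_toBase f n) hU'', ← Spec.map_comp_assoc,
      ← Spec.map_comp_assoc, ← CommRingCat.ofHom_comp]
    congr 2
    ext c
    exact congr($hj c)
  · change _ ↔ t ≫ proj f i = t ≫ proj f i'
    rw [htM, Category.assoc, Category.assoc, Category.assoc, Category.assoc,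
      cancel_epi (Spec.map (CommRingCat.ofHom j)), cancel_epi (Spec.map (CommRingCat.ofHom v))]

end Points

/-! ### The parts of a spectral datum and their weighted sum. -/

section Points
variable {S X : Scheme.{u}} (f : X ⟶ S) [IsAffine S] [Smooth f]
open CotangentPower

/-- A tuple of distinct field-valued points of the cotangent bundle defines a reduced cycle. -/
theorem mk_mem_reducedStratum {m : ℕ} {K : Type u} [Field K]
    (ζ : Spec (.of K) ⟶ CotangentPower f (Fin m))
    (h : ∀ i i', ζ ≫ proj f i = ζ ≫ proj f i' → i = i')
    (y : Spec (.of K)) : (ζ ≫ Chow.mk f m) y ∈ Chow.reducedStratum f m := by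
  -- `ζ` factors through the residue field of its image, so two coordinates that coincide there
  -- coincide for `ζ`.
  have hR : Chow.coincidence (ζ y) = ⊥ := by
    refine le_antisymm (fun i i' hi ↦ h i i' ?_) bot_le
    obtain rfl : y = IsLocalRing.closedPoint K := Subsingleton.elim (α := PrimeSpectrum K) _ _
    rw [← Scheme.descResidueField_stalkClosedPointTo_fromSpecResidueField K _ ζ, Category.assoc,
      Category.assoc]
    exact congr(_ ≫ $hi)
  have hcl : (⊥ : Setoid (Fin m)).classes = Set.range fun i ↦ {i} := by
    ext c
    constructor
    · rintro ⟨i, rfl⟩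
      exact ⟨i, rfl⟩
    · rintro ⟨i, rfl⟩
      exact ⟨i, rfl⟩
  refine ⟨ζ y, ⟨?_, fun j ↦ ?_⟩, rfl⟩
  · rw [hR, hcl]
    rintro _ ⟨i, rfl⟩
    exact (Set.ncard_singleton i).le
  -- Here `j : Fin 1` is zero, so the condition selects the singletons, that is, all classes.
  · have : {c ∈ (⊥ : Setoid (Fin m)).classes | c.ncard = (j : ℕ) + 1} =
        (fun i ↦ {i}) '' (Set.univ : Set (Fin m)) := by
      rw [hcl, Set.image_univ, Set.sep_eq_self_iff_mem_true]
      rintro _ ⟨i, rfl⟩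
      rw [Set.ncard_singleton]
      omega
    rw [hR, this, Set.ncard_image_of_injective _ Set.singleton_injective, Set.ncard_univ,
      Nat.card_fin]

theorem range_subset_closure_of_genericPoint_mem [IsIntegral X] {Y : Scheme.{u}} (g : X ⟶ Y)
    {s : Set Y} (h : g (genericPoint X) ∈ s) : Set.range g ⊆ closure s := by
  rintro _ ⟨x, rfl⟩
  exact ((genericPoint_specializes x).map g.continuous).mem_closed isClosed_closure
    (subset_closure h)

variable [IsIntegral X]

/-- The part of given multiplicity of a spectral datum is defined over `X`. -/
theorem exists_spectralDatum_part [CharZero X.functionField]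
    (hX : ∀ U : X.Opens, IsAffineOpen U → genericPoint X ∈ U → IsIntegrallyClosed Γ(X, U))
    {n s : ℕ} {α : Fin s → ℕ} {k : Type*} [Field k] [Infinite k] (c : ∀ U : X.Opens, k →+* Γ(X, U))
    (a : SpectralDatum f n) (ζ : Spec (.of (GeomField X)) ⟶ CotangentPower f (Fin n))
    (hζ : ζ ≫ Chow.mk f n = geomPoint X ≫ a.hom) {r : Fin n → Σ j : Fin s, Fin (α j)}
    (hr : ∀ x, (r ⁻¹' {x}).ncard = (x.1 : ℕ) + 1)
    (hζr : ∀ i i', ζ ≫ proj f i = ζ ≫ proj f i' ↔ r i = r i')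
    (sec : (Σ j : Fin s, Fin (α j)) → Fin n) (hsec : ∀ x, r (sec x) = x) (j : Fin s) :
    ∃ b : SpectralDatum f (α j),
      geomPoint X ≫ b.hom = ζ ≫ reindex f (fun m ↦ sec ⟨j, m⟩) ≫ Chow.mk f (α j) := by
  have hζ' : ζ ≫ toBase f (Fin n) = geomPoint X := by
    rw [← Chow.mk_toBase, reassoc_of% hζ, a.hom_toBase, Category.comp_id]
  refine exists_spectralDatum f _ (by simp only [Category.assoc, Chow.mk_toBase, reindex_toBase, hζ']) ?_
  intro U hU h φ hφ d
  have := hX U hU h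
  refine mem_range_geomEval h hU _ ?_ fun σ ↦ ?_
  -- Integrality: pulled back to the fibre power, `d` is integral over the `S_n`-invariants, and by
  -- `h2` the values of the invariants at `ζ` are the values of `a`, which lie in `Γ(X, U)`.
  · obtain ⟨ψ, hψ, -⟩ := exists_spec_map_preimage_fromSpec (toBase f (Fin n)) hU ζ (geomEval h)
      (hζ'.trans (spec_map_geomEval_fromSpec h hU).symm)
    have h1 : φ = Chow.mkApp f (α j) U ≫ reindexApp f (fun m ↦ sec ⟨j, m⟩) U ≫ ψ := by
      refine spec_map_fromSpec_inj (hU.preimage (Chow.toBase f (α j))) ?_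
      rw [hφ, ← Category.assoc (Chow.mkApp f (α j) U), Chow.mkApp_reindexApp, Spec.map_comp,
        Category.assoc, spec_map_overApp_fromSpec _ _ _ (hU.preimage (toBase f (Fin n))), reassoc_of% hψ]
    have h2 : Chow.mkApp f n U ≫ ψ = a.app U ≫ geomEval h := by
      refine spec_map_fromSpec_inj (hU.preimage (Chow.toBase f n)) ?_
      rw [a.geomPoint_hom f h hU, Chow.mkApp, Spec.map_comp, Category.assoc,
        spec_map_overApp_fromSpec _ _ _ (hU.preimage (toBase f (Fin n))), reassoc_of% hψ, hζ]
    obtain ⟨P, hP, hP'⟩ := Chow.isIntegral_mkApp f n hU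
      (reindexApp f (fun m ↦ sec ⟨j, m⟩) U (Chow.mkApp f (α j) U d))
    refine ⟨P.map (a.app U).hom, hP.map _, ?_⟩
    have h2' : (geomEval h).hom.comp (a.app U).hom = ψ.hom.comp (Chow.mkApp f n U).hom :=
      congr(($h2).hom).symm
    rw [Polynomial.eval₂_map, h2', h1]
    refine (Polynomial.hom_eval₂ _ _ ψ.hom _).symm.trans ?_
    exact (congrArg ψ.hom hP').trans (map_zero _)
  -- Galois invariance: `σ` fixes the cycle of `ζ`, so it acts on the coordinates by a permutation
  -- `g`.
  · have h1 : ζ ≫ Chow.mk f n = (galSpec σ ≫ ζ) ≫ Chow.mk f n := by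
      rw [Category.assoc, hζ, reassoc_of% galSpec_geomPoint σ]
    obtain ⟨g, hg⟩ := exists_reindex_of_mk_eq f c ζ (galSpec σ ≫ ζ) hζ' h1
    have hg' (i) : galSpec σ ≫ ζ ≫ proj f i = ζ ≫ proj f (g i) := by
      rw [reassoc_of% hg, reindex_proj]
    -- Conjugation by `σ` preserves coincidences, so `g` permutes the blocks of size `j + 1`. On the
    -- chosen representatives this is the permutation `π`, which leaves their cycle unchanged.
    obtain ⟨π, hπ⟩ := exists_perm_of_fibers hr g (fun i i' ↦ by
      rw [← hζr, ← hζr, ← hg', ← hg', cancel_epi (galSpec σ)]) sec hsec j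
    have h2 : ζ ≫ reindex f g ≫ reindex f (fun m ↦ sec ⟨j, m⟩) =
        ζ ≫ reindex f (fun m ↦ sec ⟨j, m⟩) ≫ reindex f π := by
      refine hom_ext ?_ fun m ↦ ?_
      · simp only [Category.assoc, reindex_toBase]
      · simp only [Category.assoc, reindex_proj]
        rw [hζr, hπ, hsec]
    have h3 : φ ≫ CommRingCat.ofHom (σ : GeomField X →+* GeomField X) = φ := by
      refine spec_map_fromSpec_inj (hU.preimage (Chow.toBase f (α j))) ?_
      rw [Spec.map_comp, Category.assoc, hφ]
      change galSpec σ ≫ _ = _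
      rw [reassoc_of% hg, reassoc_of% h2, Chow.reindex_mk]
    exact congr($h3 d)

/-- The decomposition of a spectral datum into its parts of given multiplicity. -/
theorem exists_spectralDatum_decomposition [CharZero X.functionField]
    (hX : ∀ U : X.Opens, IsAffineOpen U → genericPoint X ∈ U → IsIntegrallyClosed Γ(X, U))
    {n s : ℕ} {α : Fin s → ℕ} {k : Type*} [Field k] [Infinite k] (c : ∀ U : X.Opens, k →+* Γ(X, U))
    (a : SpectralDatum f n) (ha : a.hom (genericPoint X) ∈ Chow.stratum f n α)
    {τ : Chow.prod f α ⟶ Chow f n} (hτ : Chow.IsWeightedSum f τ) :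
    ∃ b : ∀ j : Fin s, SpectralDatum f (α j),
      (∀ j, (b j).hom (genericPoint X) ∈ Chow.reducedStratum f (α j)) ∧
      a.hom = SpectralDatum.tuple f b ≫ τ := by
  obtain ⟨p, ⟨hp₁, hp₂⟩, hp⟩ := ha
  obtain ⟨r, hr, hrp⟩ := exists_map_of_classes (Chow.coincidence p) hp₁ hp₂
  obtain ⟨ζ, hζ, hζp⟩ := exists_geomPoint_lift f a p hp
  have hζr (i i') : ζ ≫ proj f i = ζ ≫ proj f i' ↔ r i = r i' := (hζp i i').trans (hrp i i').symm
  have hsurj (x) : ∃ i, r i = x :=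
    Set.nonempty_of_ncard_ne_zero (s := r ⁻¹' {x}) (by rw [hr]; omega)
  -- `sec` picks one index in each block of equal points.
  choose sec hsec using hsurj
  choose b hb using exists_spectralDatum_part f hX c a ζ hζ hr hζr sec hsec
  have hζ' : ζ ≫ toBase f (Fin n) = geomPoint X := by
    rw [← Chow.mk_toBase, reassoc_of% hζ, a.hom_toBase, Category.comp_id]
  refine ⟨b, fun j ↦ ?_, eq_of_comp_geomPoint f a.hom_toBase ?_ ?_⟩
  · have h := mk_mem_reducedStratum f (ζ ≫ reindex f fun m ↦ sec ⟨j, m⟩) fun m m' hm ↦ by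
      rw [Category.assoc, Category.assoc, reindex_proj, reindex_proj, hζr, hsec, hsec] at hm
      simpa using hm
    let y : Spec (.of (GeomField X)) := (default : PrimeSpectrum (GeomField X))
    have h' := h y
    rwa [Category.assoc, ← hb, Scheme.Hom.comp_apply, geomPoint_apply] at h'
  · rw [Category.assoc, hτ.1]
    exact WidePullback.lift_base _ _ _ _
  -- At the geometric generic point, the tuple of the `b j` comes from the distinct coordinates of
  -- `ζ`; `τ` then repeats them along `r`.
  · have h1 : geomPoint X ≫ SpectralDatum.tuple f b = ζ ≫ reindex f sec ≫ Chow.prodMk f α := by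
      refine WidePullback.hom_ext _ _ _ (fun j ↦ ?_) ?_
      · refine (Category.assoc _ _ _).trans (Eq.trans ?_ (Category.assoc _ _ _).symm)
        refine (congrArg _ (WidePullback.lift_π _ _ _ _ j)).trans ((hb j).trans ?_)
        refine (congrArg (ζ ≫ ·) ?_).trans
          (congrArg (fun x ↦ ζ ≫ reindex f sec ≫ x) (Chow.prodMk_π f α j).symm)
        rw [← Category.assoc, reindex_comp]
        rfl
      · refine (Category.assoc _ _ _).trans (Eq.trans ?_ (Category.assoc _ _ _).symm)
        refine (congrArg _ (WidePullback.lift_base _ _ _ _)).trans ?_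
        refine Eq.trans ?_
          (congrArg (fun x ↦ ζ ≫ reindex f sec ≫ x) (Chow.prodMk_base f α).symm)
        rw [reindex_toBase, hζ', Category.comp_id]
    -- Replacing an index by the representative of its block does not change the coordinate of `ζ`.
    have h2 : ζ ≫ reindex f sec ≫ reindex f r = ζ := by
      refine hom_ext ?_ fun i ↦ ?_
      · simp only [Category.assoc, reindex_toBase]
      · simp only [Category.assoc, reindex_proj]
        rw [hζr, hsec]
    rw [reassoc_of% h1, hτ.2 r hr, reassoc_of% h2, hζ]

end Points

/-! ### Constants, normality and characteristic for a smooth `k`-scheme. -/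

section Smooth
variable {k : Type u} [Field k] {X : Scheme.{u}} (f : X ⟶ Spec (.of k))

/-- The inclusion of the constants into the functions on an open of a `k`-scheme. -/
noncomputable def constants (U : X.Opens) : k →+* Γ(X, U) :=
  ((Scheme.ΓSpecIso (.of k)).inv ≫ f.appLE ⊤ U le_top).hom

theorem smooth_constants [Smooth f] {U : X.Opens} (hU : IsAffineOpen U) :
    (constants f U).Smooth := by
  have h := f.smooth_appLE (isAffineOpen_top _) hU le_top
  rw [constants, CommRingCat.hom_comp]
  exact RingHom.Smooth.respectsIso.2 _ (Scheme.ΓSpecIso (.of k)).symm.commRingCatIsoToRingEquiv h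

theorem isIntegrallyClosed_of_isAffineOpen [IsIntegral X] [Smooth f] {U : X.Opens}
    (hU : IsAffineOpen U) (h : genericPoint X ∈ U) : IsIntegrallyClosed Γ(X, U) := by
  have : Nonempty U := ⟨⟨_, h⟩⟩
  let := (constants f U).toAlgebra
  have : Algebra.Smooth k Γ(X, U) := smooth_constants f hU
  exact isIntegrallyClosed_of_smooth k Γ(X, U)

theorem charZero_functionField [IsIntegral X] [CharZero k] (c : k →+* Γ(X, ⊤)) :
    CharZero X.functionField :=
  charZero_of_injective_ringHom
    ((X.presheaf.germ ⊤ (genericPoint X) trivial).hom.comp c).injective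

end Smooth

end SpectralData

theorem mainTheorem2 {k : Type u} [Field k] [IsAlgClosed k] [CharZero k]
    {X : Scheme.{u}} [IsIntegral X] (f : X ⟶ Spec (.of k)) [Smooth f]
    [SmoothOfRelativeDimension 2 f] (hproj : SpectralData.IsProjective f)
    (n s : ℕ) (α : Fin s → ℕ) (hα : ∑ j : Fin s, ((j : ℕ) + 1) * α j = n)
    (a : SpectralData.SpectralDatum f n)
    (ha : a.hom (genericPoint X) ∈ SpectralData.Chow.stratum f n α) :
    ∃ τ : SpectralData.Chow.prod f α ⟶ SpectralData.Chow f n,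
      SpectralData.Chow.IsWeightedSum f τ ∧
      ∃ b : ∀ j : Fin s, SpectralData.SpectralDatum f (α j),
        (∀ j, (b j).hom (genericPoint X) ∈ SpectralData.Chow.reducedStratum f (α j) ∧
          Set.range (b j).hom ⊆ closure (SpectralData.Chow.reducedStratum f (α j))) ∧
        a.hom = SpectralData.SpectralDatum.tuple f b ≫ τ := by
  have := SpectralData.charZero_functionField (SpectralData.constants f ⊤)
  obtain ⟨τ, hτ⟩ := SpectralData.Chow.exists_isWeightedSum f
    (fun m hm U ↦ by
      rw [← map_natCast (SpectralData.constants f U)]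
      exact (Nat.cast_ne_zero.2 hm).isUnit.map _) hα
  obtain ⟨b, hb, hab⟩ := SpectralData.exists_spectralDatum_decomposition f
    (fun U hU h ↦ SpectralData.isIntegrallyClosed_of_isAffineOpen f hU h)
    (SpectralData.constants f) a ha hτ
  exact ⟨τ, hτ, b, fun j ↦
    ⟨hb j, SpectralData.range_subset_closure_of_genericPoint_mem _ (hb j)⟩, hab⟩
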